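/- Let $\mathcal X,\mathcal A$ be non-empty sets, $d\ge 1$, $\phi:\mathcal X\times\mathcal A\to\mathbb R^d$ with $\|\phi(x,a)\|\le 1$ for all $(x,a)$, let $\sigma(w)=1/(1+e^{-w})$, let $S\ge 1$, $\Theta=\{\theta\in\mathbb R^d:\langle\mathbf 1,\theta\rangle=0,\ \|\theta\|\le S\}$ and $\theta^*\in\Theta$. Put $$\kappa=\sup_{x\in\mathcal X}\sup_{a,a'\in\mathcal A}\sup_{\theta\in\Theta}\frac1{\dot\sigma(\phi(x,a)^\top\theta-\phi(x,a')^\top\theta)},\qquad \lambda=\frac1{4S^2(2+2S)^2}.$$ Active Preference Optimization (APO) runs for $T$ rounds as follows, starting from $\widehat\theta_1=0$. In round $t$, with $z_s=\phi(x_s,a_s)-\phi(x_s,a'_s)$ and $$H_t(\theta)=\sum_{s=1}^{t-1}\dot\sigma(z_s^\top\theta)\,z_sz_s^\top+\lambda I_d,$$ it chooses a triplet $(x_t,a_t,a'_t)$ that maximizes $\|\phi(x,a)-\phi(x,a')\|_{H_t(\widehat\theta_t)^{-1}}$ over all $(x,a,a')\in\mathcal X\times\mathcal A\times\mathcal A$;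 it then observes a label $y_t\in\{0,1\}$ which, given the past and the triplet, is Bernoulli with mean $\sigma(z_t^\top\theta^*)$; and it lets $\widehat\theta_{t+1}$ be a minimizer over $\theta\in\Theta$ of the log-loss $-\sum_{s=1}^{t}\big(y_s\log\sigma(z_s^\top\theta)+(1-y_s)\log(1-\sigma(z_s^\top\theta))\big)$. After $T$ rounds it returns a policy $\pi_T$ with $\pi_T(x)\in\arg\max_{a\in\mathcal A}\phi(x,a)^\top\theta_T$ for every $x$, where $\theta_T=\frac1T\sum_{t=1}^T\widehat\theta_t$. (The maximizers are assumed to exist; ties are broken arbitrarily.) The sub-optimality gap of $\pi_T$ is $$R(T)=\sup_{x\in\mathcal X}\sup_{a\in\mathcal A}\big\{\phi(x,a)^\top\theta^*-\phi(x,\pi_T(x))^\top\theta^*\big\}.$$ There is a universal constant $C>0$ such that in this setting, for all $\delta\in(0,1]$ and all $T\ge 2$ with $ST\ge d$, with probability at least $1-\delta$, $$R(T)\le C\,S^{3/2}\sqrt{\Big(d\log\tfrac{ST}{d}+\log\tfrac T\delta\Big)\,\log\!\Big(1+\tfrac{T}{\lambda\kappa d}\Big)\,\frac{\kappa d}{T}}$$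 and, consequently (an $\widetilde O(d\sqrt{\kappa/T})$ rate), $$R(T)\le C\,S^{3/2}\,d\,\sqrt{\frac{\kappa}{T}}\;\log\frac{ST}{\delta}.$$ -/

import Mathlib

open MeasureTheory
open scoped RealInnerProductSpace Matrix

noncomputable section

namespace APO

/-- The space `ℝ^d` with the Euclidean norm. -/
abbrev Vec (d : ℕ) : Type := EuclideanSpace ℝ (Fin d)

/-- The parameter set `Θ = {θ ∈ ℝ^d | ⟨1, θ⟩ = 0, ‖θ‖ ≤ S}`. -/
def paramSet (d : ℕ) (S : ℝ) : Set (Vec d) :=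
  {θ | ∑ i, θ i = 0 ∧ ‖θ‖ ≤ S}

/-- The log-loss `L_t(θ)` of the feature differences `z 1, …, z (t-1)` and the labels
`y 1, …, y (t-1)`. -/
def logLoss {d : ℕ} (z : ℕ → Vec d) (y : ℕ → ℝ) (t : ℕ) (θ : Vec d) : ℝ :=
  -∑ s ∈ Finset.Ico 1 t,
    (y s * Real.log (Real.sigmoid ⟪z s, θ⟫)
      + (1 - y s) * Real.log (1 - Real.sigmoid ⟪z s, θ⟫))

/-- The regularized design matrix
`H_t(θ) = ∑_{s=1}^{t-1} σ'(⟨z_s, θ⟩) z_s z_sᵀ + lam • I_d`. -/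
def designMatrix {d : ℕ} (lam : ℝ) (z : ℕ → Vec d) (t : ℕ) (θ : Vec d) :
    Matrix (Fin d) (Fin d) ℝ :=
  ∑ s ∈ Finset.Ico 1 t,
      deriv Real.sigmoid ⟪z s, θ⟫ • Matrix.vecMulVec (z s).ofLp (z s).ofLp
    + lam • (1 : Matrix (Fin d) (Fin d) ℝ)

/-- The weighted norm `‖v‖_M = √(vᵀ M v)`. -/
def matNorm {d : ℕ} (M : Matrix (Fin d) (Fin d) ℝ) (v : Vec d) : ℝ :=
  Real.sqrt (v.ofLp ⬝ᵥ (M *ᵥ v.ofLp))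

/-- The exploration bonus `b_t(x, a, a') = ‖φ(x,a) - φ(x,a')‖_{H_t(θ)⁻¹}`. -/
def bonus {X A : Type*} {d : ℕ} (φ : X → A → Vec d) (lam : ℝ) (z : ℕ → Vec d) (t : ℕ)
    (θ : Vec d) (x : X) (a a' : A) : ℝ :=
  matNorm (designMatrix lam z t θ)⁻¹ (φ x a - φ x a')

/-- The non-linearity parameter
`κ = max_{x, a, a'} max_{θ ∈ Θ} 1 / σ'(⟨φ(x,a), θ⟩ - ⟨φ(x,a'), θ⟩)`. -/
def kappa {X A : Type*} {d : ℕ} (φ : X → A → Vec d) (S : ℝ) : ℝ :=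
  ⨆ p : X × A × A × paramSet d S,
    1 / deriv Real.sigmoid
      (⟪φ p.1 p.2.1, (p.2.2.2 : Vec d)⟫ - ⟪φ p.1 p.2.2.1, (p.2.2.2 : Vec d)⟫)

/-- The averaged estimate `θ_T = (1/T) ∑_{t=1}^T θhat_t`. -/
def avgParam {d : ℕ} (T : ℕ) (θhat : ℕ → Vec d) : Vec d :=
  (1 / (T : ℝ)) • ∑ t ∈ Finset.Icc 1 T, θhat t

/-- The sub-optimality gap `max_x max_a {r*(x,a) - r*(x,π(x))}` of the policy `π`, where
`r*(x,a) = ⟨φ(x,a), θstar⟩`. -/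
def gap {X A : Type*} {d : ℕ} (φ : X → A → Vec d) (θstar : Vec d) (π : X → A) : ℝ :=
  ⨆ x : X, ⨆ a : A, (⟪φ x a, θstar⟫ - ⟪φ x (π x), θstar⟫)

/-- `x, a, a', y, θhat, π` are the contexts, the duelling actions, the labels, the parameter
estimates and the returned policy of a run of `T` rounds of Active Preference Optimization with
regularization `lam`, against labels from the Bradley-Terry-Luce model with reward
`⟨φ(·,·), θstar⟩`. Rounds are numbered `1, …, T`. The σ-algebra `ℱ t` is the information available
in round `t` after the triplet is chosen and before the label is revealed. Ties in every argmin and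
argmax may be broken in any way. -/
structure IsRun {X A Ω : Type*} [mΩ : MeasurableSpace Ω] {d : ℕ} (μ : Measure Ω)
    (ℱ : Filtration ℕ mΩ) (φ : X → A → Vec d) (S lam : ℝ) (θstar : Vec d) (T : ℕ)
    (x : ℕ → Ω → X) (a a' : ℕ → Ω → A) (y : ℕ → Ω → ℝ) (θhat : ℕ → Ω → Vec d)
    (π : Ω → X → A) : Prop where
  /-- The first estimate is zero. -/
  init : ∀ ω, θhat 1 ω = 0
  /-- `θhat_t` minimizes the log-loss of the first `t - 1` rounds over `Θ`. -/
  estimate : ∀ t ∈ Finset.Icc 1 T, ∀ ω,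
    θhat t ω ∈ paramSet d S ∧
      IsMinOn (logLoss (fun s => φ (x s ω) (a s ω) - φ (x s ω) (a' s ω)) (fun s => y s ω) t)
        (paramSet d S) (θhat t ω)
  /-- The triplet of round `t` maximizes the exploration bonus over all triplets. -/
  select : ∀ t ∈ Finset.Icc 1 T, ∀ ω, ∀ (x₀ : X) (a₀ a₀' : A),
    bonus φ lam (fun s => φ (x s ω) (a s ω) - φ (x s ω) (a' s ω)) t (θhat t ω) x₀ a₀ a₀' ≤
      bonus φ lam (fun s => φ (x s ω) (a s ω) - φ (x s ω) (a' s ω)) t (θhat t ω)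
        (x t ω) (a t ω) (a' t ω)
  /-- The feature difference of round `t` is determined by the information of round `t`. -/
  adapted : ∀ t ∈ Finset.Icc 1 T,
    Measurable[ℱ t] fun ω => φ (x t ω) (a t ω) - φ (x t ω) (a' t ω)
  /-- Labels are binary. -/
  label_binary : ∀ t ∈ Finset.Icc 1 T, ∀ ω, y t ω = 0 ∨ y t ω = 1
  /-- The label of round `t` is known from round `t + 1` on. -/
  label_adapted : ∀ t ∈ Finset.Icc 1 T, Measurable[ℱ (t + 1)] (y t)
  /-- Given the information of round `t`, the label `y_t` is Bernoulli with mean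
  `σ(⟨z_t, θstar⟩)`. -/
  label_law : ∀ t ∈ Finset.Icc 1 T,
    μ[y t | ℱ t] =ᵐ[μ]
      fun ω => Real.sigmoid ⟪φ (x t ω) (a t ω) - φ (x t ω) (a' t ω), θstar⟫
  /-- The returned policy is greedy for the averaged estimate. -/
  policy : ∀ ω, ∀ (x₀ : X) (a₀ : A),
    ⟪φ x₀ a₀, avgParam T (fun t => θhat t ω)⟫ ≤
      ⟪φ x₀ (π ω x₀), avgParam T (fun t => θhat t ω)⟫

end APO

end

namespace APO

/-! On a confidence event the true parameter has log-loss at most `β` above any parameter of norm at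
most `S`, in every round. For fixed `θ` the likelihood ratio against `θstar` has mean one, so
Markov's inequality and a union bound over rounds and a net of the `S`-ball give `β` of order `d log
(S T / d) + log (T / δ)` (`IsFeedback.exists_confidence`).

The estimate minimizes a convex loss, so the gradient term of the loss difference is nonnegative.
Self-concordance of `log (1 + exp w)` (`log_one_add_exp_add_ge`) turns what remains into `‖θstar -
θhat t‖² ≲ S β` in the norm of the design matrix at `θhat t`, with a factor linear in `S` rather
than exponential (`designMatrix_error_le`).

The greedy rule bounds the gap by the average over `t` of `⟪w, θstar - θhat t⟫` for one feature
difference `w`. The triplet played in round `t` is at least as uncertain as `w`, so dual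
Cauchy-Schwarz replaces `w` by `z t`. Passing to the unweighted Gram matrix costs a factor `κ`, and
the squared bonuses then sum by the elliptic potential lemma (`inner_error_avgParam_le`). If `S T <
3 d`, the trivial bound `2 S` is already small enough. -/

/-! ### The logistic function and its self-concordance -/

lemma one_sub_sigmoid (w : ℝ) : 1 - Real.sigmoid w = (1 + Real.exp w)⁻¹ := by
  rw [← Real.sigmoid_neg, Real.sigmoid_def, neg_neg]

lemma log_one_sub_sigmoid (w : ℝ) :
    Real.log (1 - Real.sigmoid w) = -Real.log (1 + Real.exp w) := by
  rw [one_sub_sigmoid, Real.log_inv]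

lemma sigmoid_eq_exp_mul (w : ℝ) : Real.sigmoid w = Real.exp w * (1 + Real.exp w)⁻¹ := by
  have h := Real.sigmoid_mul_rexp_neg (-w)
  rw [neg_neg, Real.sigmoid_neg, one_sub_sigmoid] at h
  rw [← h, mul_comm]

lemma log_sigmoid (w : ℝ) : Real.log (Real.sigmoid w) = w - Real.log (1 + Real.exp w) := by
  have h := Real.exp_pos w
  rw [sigmoid_eq_exp_mul, Real.log_mul (by positivity) (by positivity), Real.log_exp,
    Real.log_inv, sub_eq_add_neg]

lemma hasDerivAt_log_one_add_exp (w : ℝ) :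
    HasDerivAt (fun w => Real.log (1 + Real.exp w)) (Real.sigmoid w) w := by
  have h := ((Real.hasDerivAt_exp w).const_add 1).log (by positivity)
  rw [sigmoid_eq_exp_mul]
  simpa [div_eq_mul_inv] using h

/-- With `E = exp w` and `F = exp h`, the two sides are `E (F - 1) / (1 + E)` divided by `(1 + E) F`
and by `1 + E F`. This is the integrated form of the fact that `σ'` decays no faster than `exp
(-h)`. -/
lemma sigmoid_add_sub_ge (w : ℝ) {h : ℝ} (hh : 0 ≤ h) :
    Real.sigmoid w * (1 - Real.sigmoid w) * (1 - Real.exp (-h)) ≤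
      Real.sigmoid (w + h) - Real.sigmoid w := by
  have hE := Real.exp_pos w
  have hF := Real.exp_pos h
  have hF1 : 1 ≤ Real.exp h := Real.one_le_exp hh
  rw [one_sub_sigmoid, sigmoid_eq_exp_mul, sigmoid_eq_exp_mul, Real.exp_add, Real.exp_neg]
  set E := Real.exp w
  set F := Real.exp h
  have h1 : E * F * (1 + E * F)⁻¹ - E * (1 + E)⁻¹ = E * (F - 1) * ((1 + E * F)⁻¹ * (1 + E)⁻¹) := by
    field_simp
    ring
  have h2 : E * (1 + E)⁻¹ * (1 + E)⁻¹ * (1 - F⁻¹) =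
      E * (F - 1) * (((1 + E) * F)⁻¹ * (1 + E)⁻¹) := by
    field_simp
  rw [h1, h2]
  have : 1 + E * F ≤ (1 + E) * F := by nlinarith
  have : 0 ≤ E * (F - 1) := mul_nonneg hE.le (by linarith)
  gcongr

/-- Square `1 + h / 2 ≤ exp (h / 2)`. The form is chosen because `1 - 4 / (2 + h) ^ 2` is the
derivative of `h ^ 2 / (2 + h)`. -/
lemma exp_neg_le_four_div {h : ℝ} (hh : 0 ≤ h) : Real.exp (-h) ≤ 4 / (2 + h) ^ 2 := by
  have h1 : h / 2 + 1 ≤ Real.exp (h / 2) := Real.add_one_le_exp _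
  have h2 : Real.exp h = Real.exp (h / 2) ^ 2 := by
    rw [← Real.exp_nat_mul]; congr 1; push_cast; ring
  rw [Real.exp_neg, h2, le_div_iff₀ (by positivity), inv_mul_le_iff₀ (by positivity)]
  nlinarith

lemma log_one_add_exp_add_ge_of_nonneg (w : ℝ) {h : ℝ} (hh : 0 ≤ h) :
    Real.sigmoid w * h + Real.sigmoid w * (1 - Real.sigmoid w) * h ^ 2 / (2 + h) ≤
      Real.log (1 + Real.exp (w + h)) - Real.log (1 + Real.exp w) := by
  set c := Real.sigmoid w * (1 - Real.sigmoid w) with hc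
  have hc0 : 0 ≤ c := mul_nonneg (Real.sigmoid_nonneg _) (by linarith [Real.sigmoid_le_one w])
  have hd : ∀ u ∈ Set.Ici (0 : ℝ), HasDerivAt (fun u => Real.log (1 + Real.exp (w + u))
      - Real.sigmoid w * u - c * u ^ 2 / (2 + u))
      (Real.sigmoid (w + u) - Real.sigmoid w - c * (1 - 4 / (2 + u) ^ 2)) u := by
    intro u hu
    have hu : 0 ≤ u := hu
    have h1 : HasDerivAt (fun u => Real.log (1 + Real.exp (w + u))) (Real.sigmoid (w + u)) u := by
      exact (hasDerivAt_log_one_add_exp (w + u)).comp_const_add w u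
    have h2 : HasDerivAt (fun u => Real.sigmoid w * u) (Real.sigmoid w) u := by
      simpa using (hasDerivAt_id u).const_mul (Real.sigmoid w)
    have h3 := (((hasDerivAt_pow 2 u).const_mul c).div ((hasDerivAt_id u).const_add 2)
      (by simp; positivity))
    convert! (h1.sub h2).sub h3 using 1
    simp only [id]
    field_simp
    ring
  have hmono : MonotoneOn (fun u => Real.log (1 + Real.exp (w + u))
      - Real.sigmoid w * u - c * u ^ 2 / (2 + u)) (Set.Ici 0) := by
    apply monotoneOn_of_hasDerivWithinAt_nonneg (convex_Ici 0)
      (fun u hu => (hd u hu).continuousAt.continuousWithinAt)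
      (fun u hu => (hd u (interior_subset hu)).hasDerivWithinAt)
    intro u hu
    have hu : 0 ≤ u := (interior_subset hu : u ∈ Set.Ici (0 : ℝ))
    have h1 := sigmoid_add_sub_ge w hu
    have h2 := mul_le_mul_of_nonneg_left (exp_neg_le_four_div hu) hc0
    rw [← hc] at h1
    linarith
  have := hmono (Set.mem_Ici.2 le_rfl) (Set.mem_Ici.2 hh) hh
  simp only [add_zero, mul_zero, sub_zero] at this
  norm_num at this
  linarith

lemma log_one_add_exp_neg (w : ℝ) :
    Real.log (1 + Real.exp (-w)) = Real.log (1 + Real.exp w) - w := by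
  have h := log_sigmoid w
  rw [Real.sigmoid_def, Real.log_inv] at h
  linarith

/-- A self-concordance lower bound on the Bregman divergence of `w ↦ log (1 + exp w)`. -/
lemma log_one_add_exp_add_ge (w h : ℝ) :
    Real.sigmoid w * h + Real.sigmoid w * (1 - Real.sigmoid w) * h ^ 2 / (2 + |h|) ≤
      Real.log (1 + Real.exp (w + h)) - Real.log (1 + Real.exp w) := by
  rcases le_total 0 h with hh | hh
  · rw [abs_of_nonneg hh]
    exact log_one_add_exp_add_ge_of_nonneg w hh
  · rw [abs_of_nonpos hh]
    have := log_one_add_exp_add_ge_of_nonneg (-w) (h := -h) (by linarith)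
    rw [← neg_add, log_one_add_exp_neg, log_one_add_exp_neg, Real.sigmoid_neg, neg_sq,
      sub_sub_cancel, mul_comm (1 - _) (Real.sigmoid w)] at this
    linarith

/-! ### The log-loss: curvature, optimality, Lipschitz bound -/

variable {d : ℕ}

lemma logLoss_eq (z : ℕ → Vec d) (y : ℕ → ℝ) (t : ℕ) (θ : Vec d) :
    logLoss z y t θ =
      ∑ s ∈ Finset.Ico 1 t, (Real.log (1 + Real.exp ⟪z s, θ⟫) - y s * ⟪z s, θ⟫) := by
  rw [logLoss, ← Finset.sum_neg_distrib]
  refine Finset.sum_congr rfl fun s _ => ?_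
  rw [log_sigmoid, log_one_sub_sigmoid]
  ring

lemma logLoss_sub_ge (z : ℕ → Vec d) (y : ℕ → ℝ) (t : ℕ) (θ θ' : Vec d) :
    ∑ s ∈ Finset.Ico 1 t, (Real.sigmoid ⟪z s, θ⟫ - y s) * ⟪z s, θ' - θ⟫
      + ∑ s ∈ Finset.Ico 1 t,
        deriv Real.sigmoid ⟪z s, θ⟫ * ⟪z s, θ' - θ⟫ ^ 2 / (2 + |⟪z s, θ' - θ⟫|) ≤
      logLoss z y t θ' - logLoss z y t θ := by
  rw [logLoss_eq, logLoss_eq, ← Finset.sum_add_distrib, ← Finset.sum_sub_distrib]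
  refine Finset.sum_le_sum fun s _ => ?_
  have h := log_one_add_exp_add_ge ⟪z s, θ⟫ ⟪z s, θ' - θ⟫
  have e : ⟪z s, θ'⟫ = ⟪z s, θ⟫ + ⟪z s, θ' - θ⟫ := by rw [inner_sub_right]; ring
  rw [e, Real.deriv_sigmoid]
  simp only
  linarith

lemma convex_paramSet (S : ℝ) : Convex ℝ (paramSet d S) := by
  intro p hp q hq u v hu hv huv
  refine ⟨?_, ?_⟩
  · simp [Finset.sum_add_distrib, ← Finset.mul_sum, hp.1, hq.1]
  · calc ‖u • p + v • q‖ ≤ ‖u • p‖ + ‖v • q‖ := norm_add_le _ _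
      _ = u * ‖p‖ + v * ‖q‖ := by
        rw [norm_smul, norm_smul, Real.norm_of_nonneg hu, Real.norm_of_nonneg hv]
      _ ≤ u * S + v * S := by gcongr; exacts [hp.2, hq.2]
      _ = S := by rw [← add_mul, huv, one_mul]

/-- First-order optimality of a minimizer of the log-loss over the parameter set. -/
lemma logLoss_gradient_nonneg {z : ℕ → Vec d} {y : ℕ → ℝ} {t : ℕ} {S : ℝ} {θ θ' : Vec d}
    (hθ : θ ∈ paramSet d S) (hθ' : θ' ∈ paramSet d S)
    (hmin : IsMinOn (logLoss z y t) (paramSet d S) θ) :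
    0 ≤ ∑ s ∈ Finset.Ico 1 t, (Real.sigmoid ⟪z s, θ⟫ - y s) * ⟪z s, θ' - θ⟫ := by
  set g : ℝ → ℝ := fun v => logLoss z y t (θ + v • (θ' - θ)) with hg
  have hd : HasDerivAt g
      (∑ s ∈ Finset.Ico 1 t, (Real.sigmoid ⟪z s, θ⟫ - y s) * ⟪z s, θ' - θ⟫) 0 := by
    simp only [hg, logLoss_eq]
    refine HasDerivAt.fun_sum fun s _ => ?_
    have hl : HasDerivAt (fun v : ℝ => ⟪z s, θ + v • (θ' - θ)⟫) ⟪z s, θ' - θ⟫ 0 := by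
      simp only [inner_add_right, inner_smul_right]
      simpa using ((hasDerivAt_id (0 : ℝ)).mul_const ⟪z s, θ' - θ⟫).const_add ⟪z s, θ⟫
    have h1 := (hasDerivAt_log_one_add_exp ⟪z s, θ + (0 : ℝ) • (θ' - θ)⟫).comp 0 hl
    convert! h1.sub (hl.const_mul (y s)) using 1
    simp
    ring
  have hmin' : IsMinOn g (Set.Icc 0 1) 0 := by
    intro v hv
    have hmem : θ + v • (θ' - θ) ∈ paramSet d S :=
      (convex_paramSet S).add_smul_sub_mem hθ hθ' hv
    have := hmin hmem
    simpa [hg] using this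
  have := hmin'.localize.hasFDerivWithinAt_nonneg hd.hasFDerivAt.hasFDerivWithinAt (y := 1)
    (mem_posTangentConeAt_of_segment_subset (by simp [segment_eq_Icc]))
  simpa using this

/-- The loss of one label is convex in `w` with slope `σ(w) - c` in `[-1, 1]`, hence 1-Lipschitz. -/
lemma log_one_add_exp_sub_mul_sub_le (w w' : ℝ) {c : ℝ} (h0 : 0 ≤ c) (h1 : c ≤ 1) :
    (Real.log (1 + Real.exp w) - c * w) - (Real.log (1 + Real.exp w') - c * w') ≤ |w - w'| := by
  have h := log_one_add_exp_add_ge w (w' - w)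
  have hs0 := Real.sigmoid_nonneg w
  have hs1 := Real.sigmoid_le_one w
  rw [add_sub_cancel] at h
  have hq : 0 ≤ Real.sigmoid w * (1 - Real.sigmoid w) * (w' - w) ^ 2 / (2 + |w' - w|) := by
    have : 0 ≤ 1 - Real.sigmoid w := by linarith
    positivity
  have h2 : (Real.sigmoid w - c) * (w - w') ≤ |w - w'| := by
    calc _ ≤ |(Real.sigmoid w - c) * (w - w')| := le_abs_self _
      _ = |Real.sigmoid w - c| * |w - w'| := abs_mul _ _
      _ ≤ 1 * |w - w'| := by
        gcongr
        rw [abs_le]; constructor <;> linarith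
      _ = _ := one_mul _
  linarith

lemma logLoss_sub_le {z : ℕ → Vec d} {y : ℕ → ℝ} {t T : ℕ} (ht : t ≤ T + 1)
    (hz : ∀ s ∈ Finset.Ico 1 t, ‖z s‖ ≤ 2) (hy : ∀ s ∈ Finset.Ico 1 t, y s = 0 ∨ y s = 1)
    (θ θ' : Vec d) : logLoss z y t θ - logLoss z y t θ' ≤ 2 * T * ‖θ - θ'‖ := by
  rw [logLoss_eq, logLoss_eq, ← Finset.sum_sub_distrib]
  calc _ ≤ ∑ s ∈ Finset.Ico 1 t, 2 * ‖θ - θ'‖ := by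
        refine Finset.sum_le_sum fun s hs => ?_
        refine (log_one_add_exp_sub_mul_sub_le _ _ ?_ ?_).trans ?_
        · rcases hy s hs with h | h <;> simp [h]
        · rcases hy s hs with h | h <;> simp [h]
        · rw [← inner_sub_right]
          refine (abs_real_inner_le_norm _ _).trans ?_
          gcongr
          exact hz s hs
    _ = ((t - 1 : ℕ) : ℝ) * (2 * ‖θ - θ'‖) := by simp
    _ ≤ (T : ℝ) * (2 * ‖θ - θ'‖) := by
        gcongr
        omega
    _ = _ := by ring

/-! ### Finite nets of balls -/

/-- Volume comparison: the balls of radius `ε / 2` around the points are disjoint and lie in the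
ball of radius `R + ε / 2`. -/
lemma card_le_of_separated {E : Type*} [NormedAddCommGroup E] [NormedSpace ℝ E]
    [FiniteDimensional ℝ E] {R ε : ℝ} (hR : 0 ≤ R) (hε : 0 < ε) (s : Finset E)
    (hs : ∀ c ∈ s, ‖c‖ ≤ R) (h : ∀ c ∈ s, ∀ e ∈ s, c ≠ e → ε ≤ ‖c - e‖) :
    (s.card : ℝ) ≤ (1 + 2 * R / ε) ^ Module.finrank ℝ E := by
  borelize E
  let μ : Measure E := Measure.addHaar
  have hρ : 0 < R + ε / 2 := by positivity
  have hδ : 0 < ε / 2 := by positivity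
  set A := ⋃ c ∈ s, Metric.ball (c : E) (ε / 2) with hA
  have D : Set.Pairwise (s : Set E)
      (Function.onFun Disjoint fun c => Metric.ball (c : E) (ε / 2)) := by
    rintro c hc e he hce
    apply Metric.ball_disjoint_ball
    rw [dist_eq_norm]
    linarith [h c hc e he hce]
  have A_subset : A ⊆ Metric.ball (0 : E) (R + ε / 2) := by
    refine Set.iUnion₂_subset fun x hx => ?_
    apply Metric.ball_subset_ball'
    rw [dist_zero_right]
    linarith [hs x hx]
  have I : (s.card : ENNReal) * ENNReal.ofReal ((ε / 2) ^ Module.finrank ℝ E)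
        * μ (Metric.ball 0 1) ≤
      ENNReal.ofReal ((R + ε / 2) ^ Module.finrank ℝ E) * μ (Metric.ball 0 1) :=
    calc _ = μ A := by
          rw [hA, measure_biUnion_finset D fun c _ => measurableSet_ball]
          simp only [μ.addHaar_ball_of_pos _ hδ]
          simp only [Finset.sum_const, nsmul_eq_mul, mul_assoc]
      _ ≤ μ (Metric.ball (0 : E) (R + ε / 2)) := measure_mono A_subset
      _ = _ := by simp only [μ.addHaar_ball_of_pos _ hρ]
  have J : (s.card : ENNReal) * ENNReal.ofReal ((ε / 2) ^ Module.finrank ℝ E) ≤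
      ENNReal.ofReal ((R + ε / 2) ^ Module.finrank ℝ E) :=
    (ENNReal.mul_le_mul_iff_left (Metric.measure_ball_pos _ _ zero_lt_one).ne'
      measure_ball_lt_top.ne).1 I
  have K := ENNReal.toReal_le_of_le_ofReal (pow_nonneg hρ.le _) J
  rw [ENNReal.toReal_mul, ENNReal.toReal_natCast,
    ENNReal.toReal_ofReal (by positivity)] at K
  have e : 1 + 2 * R / ε = (R + ε / 2) / (ε / 2) := by field_simp; ring
  rw [e, div_pow, le_div_iff₀ (by positivity)]
  exact K

/-- A ball of radius `R` has an `ε`-net with at most `(1 + 2R/ε)^dim` points. -/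
lemma exists_net {E : Type*} [NormedAddCommGroup E] [NormedSpace ℝ E]
    [FiniteDimensional ℝ E] {R ε : ℝ} (hR : 0 ≤ R) (hε : 0 < ε) :
    ∃ s : Finset E, (∀ c ∈ s, ‖c‖ ≤ R) ∧ (∀ v : E, ‖v‖ ≤ R → ∃ c ∈ s, ‖c - v‖ ≤ ε) ∧
      (s.card : ℝ) ≤ (1 + 2 * R / ε) ^ Module.finrank ℝ E := by
  classical
  let P : Finset E → Prop := fun s =>
    (∀ c ∈ s, ‖c‖ ≤ R) ∧ ∀ c ∈ s, ∀ e ∈ s, c ≠ e → ε ≤ ‖c - e‖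
  have hfin : (Finset.card '' {s | P s}).Finite := by
    refine (Set.finite_Iic ⌊(1 + 2 * R / ε) ^ Module.finrank ℝ E⌋₊).subset ?_
    rintro _ ⟨s, hs, rfl⟩
    exact Nat.le_floor (card_le_of_separated hR hε s hs.1 hs.2)
  -- A separated set of largest cardinality is a net, since an uncovered point could be added to it.
  obtain ⟨_, ⟨s, hs, rfl⟩, hmax⟩ := Set.exists_max_image _ id hfin ⟨0, ∅, by simp [P], rfl⟩
  refine ⟨s, hs.1, fun v hv => ?_, card_le_of_separated hR hε s hs.1 hs.2⟩
  by_contra! hcon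
  have hvs : v ∉ s := fun hvs => by
    have := hcon v hvs
    simp at this
    linarith
  have hP : P (insert v s) := by
    refine ⟨fun c hc => ?_, fun c hc e he hce => ?_⟩
    · rcases Finset.mem_insert.1 hc with rfl | hc
      exacts [hv, hs.1 c hc]
    · rcases Finset.mem_insert.1 hc with rfl | hc' <;> rcases Finset.mem_insert.1 he with rfl | he'
      · exact absurd rfl hce
      · rw [norm_sub_rev]; exact (hcon e he').le
      · exact (hcon c hc').le
      · exact hs.2 c hc' e he' hce
  have := hmax _ ⟨_, hP, rfl⟩
  simp only [id, Finset.card_insert_of_notMem hvs] at this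
  omega

/-! ### Positive definite matrices -/

section Matrices

variable {n : Type*} [Fintype n]

lemma dotProduct_vecMulVec_mulVec (u v : n → ℝ) :
    v ⬝ᵥ Matrix.vecMulVec u u *ᵥ v = (u ⬝ᵥ v) ^ 2 := by
  rw [Matrix.vecMulVec_mulVec, sq]
  simp [dotProduct_comm v u]

lemma posSemidef_vecMulVec_self (u : n → ℝ) : (Matrix.vecMulVec u u).PosSemidef := by
  simpa using Matrix.posSemidef_vecMulVec_self_star u

variable [DecidableEq n]

lemma dotProduct_mulVec_sq_le {M : Matrix n n ℝ} (hM : M.PosSemidef) (x y : n → ℝ) :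
    (x ⬝ᵥ M *ᵥ y) ^ 2 ≤ (x ⬝ᵥ M *ᵥ x) * (y ⬝ᵥ M *ᵥ y) := by
  have hsymm : y ⬝ᵥ M *ᵥ x = x ⬝ᵥ M *ᵥ y := by
    have hT : Mᵀ = M := by simpa using hM.isHermitian.eq
    rw [Matrix.dotProduct_mulVec, ← Matrix.mulVec_transpose, hT, dotProduct_comm]
  have h := LinearMap.BilinForm.apply_mul_apply_le_of_forall_zero_le (Matrix.toLinearMap₂' ℝ M)
    (fun x => by simpa [Matrix.toLinearMap₂'_apply'] using hM.dotProduct_mulVec_nonneg x) x y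
  simp only [Matrix.toLinearMap₂'_apply'] at h
  rw [hsymm] at h
  rwa [sq]

lemma mulVec_inv_mulVec {M : Matrix n n ℝ} (hM : M.PosDef) (x : n → ℝ) :
    M *ᵥ (M⁻¹ *ᵥ x) = x := by
  rw [Matrix.mulVec_mulVec, Matrix.mul_nonsing_inv _ ((Matrix.isUnit_iff_isUnit_det _).1 hM.isUnit),
    Matrix.one_mulVec]

/-- Cauchy-Schwarz for the dual norms of a positive definite matrix. -/
lemma dotProduct_sq_le_inv {M : Matrix n n ℝ} (hM : M.PosDef) (x y : n → ℝ) :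
    (x ⬝ᵥ y) ^ 2 ≤ (x ⬝ᵥ M⁻¹ *ᵥ x) * (y ⬝ᵥ M *ᵥ y) := by
  have h := dotProduct_mulVec_sq_le hM.posSemidef y (M⁻¹ *ᵥ x)
  rw [mulVec_inv_mulVec hM, dotProduct_comm y x, dotProduct_comm (M⁻¹ *ᵥ x) x] at h
  linarith

lemma inv_dotProduct_nonneg {M : Matrix n n ℝ} (hM : M.PosDef) (x : n → ℝ) :
    0 ≤ x ⬝ᵥ M⁻¹ *ᵥ x := by
  simpa using hM.inv.posSemidef.dotProduct_mulVec_nonneg x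

/-- Inversion is antitone on positive definite matrices, up to a scalar. -/
lemma inv_dotProduct_le {M N : Matrix n n ℝ} (hM : M.PosDef) (hN : N.PosDef) {c : ℝ}
    (hMN : ∀ v, v ⬝ᵥ M *ᵥ v ≤ c * (v ⬝ᵥ N *ᵥ v)) (x : n → ℝ) :
    x ⬝ᵥ N⁻¹ *ᵥ x ≤ c * (x ⬝ᵥ M⁻¹ *ᵥ x) := by
  -- Against `N⁻¹ x`, dual Cauchy-Schwarz bounds the square of `x ⬝ᵥ N⁻¹ *ᵥ x` by `c` times itself
  -- times `x ⬝ᵥ M⁻¹ *ᵥ x`; one factor then cancels.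
  have h := dotProduct_sq_le_inv hM x (N⁻¹ *ᵥ x)
  have h1 := hMN (N⁻¹ *ᵥ x)
  rw [mulVec_inv_mulVec hN, dotProduct_comm (N⁻¹ *ᵥ x) x] at h1
  have h2 := inv_dotProduct_nonneg hM x
  have h3 := inv_dotProduct_nonneg hN x
  have h4 := mul_le_mul_of_nonneg_left h1 h2
  rcases h3.eq_or_lt with h0 | h0
  · rcases eq_or_ne x 0 with rfl | hx
    · simp
    · have := hN.inv.dotProduct_mulVec_pos hx
      simp at this
      linarith
  · nlinarith

lemma det_add_vecMulVec {M : Matrix n n ℝ} (hM : M.PosDef) (u : n → ℝ) :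
    (M + Matrix.vecMulVec u u).det = M.det * (1 + u ⬝ᵥ M⁻¹ *ᵥ u) := by
  rw [Matrix.vecMulVec_eq Unit, Matrix.det_add_replicateCol_mul_replicateRow
    ((Matrix.isUnit_iff_isUnit_det _).1 hM.isUnit)]
  congr 1
  rw [Matrix.det_unique, Matrix.add_apply, Matrix.one_apply_eq, Matrix.mul_assoc,
    ← Matrix.replicateCol_mulVec, Matrix.replicateRow_mul_replicateCol_apply]

/-- AM-GM for the eigenvalues. -/
lemma det_le_trace_div_pow [Nonempty n] {M : Matrix n n ℝ} (hM : M.PosSemidef) :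
    M.det ≤ (M.trace / Fintype.card n) ^ Fintype.card n := by
  have hd : M.det = ∏ i, hM.isHermitian.eigenvalues i := by
    simpa using hM.isHermitian.det_eq_prod_eigenvalues
  have ht : M.trace = ∑ i, hM.isHermitian.eigenvalues i := by
    simpa using hM.isHermitian.trace_eq_sum_eigenvalues
  have hc : (0 : ℝ) < Fintype.card n := by exact_mod_cast Fintype.card_pos
  have h := Real.geom_mean_le_arith_mean_weighted Finset.univ (fun _ => 1 / (Fintype.card n : ℝ))
    hM.isHermitian.eigenvalues (fun _ _ => by positivity) (by simp [hc.ne'])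
    (fun i _ => hM.eigenvalues_nonneg i)
  rw [Real.finsetProd_rpow _ _ (fun i _ => hM.eigenvalues_nonneg i), ← hd, ← Finset.mul_sum,
    ← ht] at h
  have h0 := hM.det_nonneg
  calc M.det = (M.det ^ (1 / (Fintype.card n : ℝ))) ^ Fintype.card n := by
        rw [← Real.rpow_natCast, ← Real.rpow_mul h0, one_div_mul_cancel hc.ne', Real.rpow_one]
    _ ≤ (1 / (Fintype.card n : ℝ) * M.trace) ^ Fintype.card n := by gcongr
    _ = _ := by rw [one_div, inv_mul_eq_div]

end Matrices

/-! ### Design matrices and the elliptic potential -/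

lemma inner_eq_dotProduct (u v : Vec d) : ⟪u, v⟫ = u.ofLp ⬝ᵥ v.ofLp := by
  rw [EuclideanSpace.inner_eq_star_dotProduct, star_trivial, dotProduct_comm]

lemma norm_sq_eq_dotProduct (u : Vec d) : ‖u‖ ^ 2 = u.ofLp ⬝ᵥ u.ofLp := by
  rw [← real_inner_self_eq_norm_sq, inner_eq_dotProduct]

/-- The regularized Gram matrix of the feature differences. -/
noncomputable def gram (c : ℝ) (z : ℕ → Vec d) (t : ℕ) : Matrix (Fin d) (Fin d) ℝ :=
  ∑ s ∈ Finset.Ico 1 t, Matrix.vecMulVec (z s).ofLp (z s).ofLp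
    + c • (1 : Matrix (Fin d) (Fin d) ℝ)

lemma gram_posDef {c : ℝ} (hc : 0 < c) (z : ℕ → Vec d) (t : ℕ) : (gram c z t).PosDef :=
  Matrix.PosDef.posSemidef_add
    (Matrix.posSemidef_sum _ fun _ _ => posSemidef_vecMulVec_self _) (Matrix.PosDef.one.smul hc)

lemma deriv_sigmoid_pos (w : ℝ) : 0 < deriv Real.sigmoid w := by
  rw [Real.deriv_sigmoid]
  exact mul_pos (Real.sigmoid_pos w) (by linarith [Real.sigmoid_lt_one w])

lemma designMatrix_posDef {lam : ℝ} (hlam : 0 < lam) (z : ℕ → Vec d) (t : ℕ) (θ : Vec d) :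
    (designMatrix lam z t θ).PosDef :=
  Matrix.PosDef.posSemidef_add
    (Matrix.posSemidef_sum _ fun _ _ => (posSemidef_vecMulVec_self _).smul
      (deriv_sigmoid_pos _).le) (Matrix.PosDef.one.smul hlam)

lemma dotProduct_sum_smul_vecMulVec_mulVec (c : ℝ) (α : ℕ → ℝ) (z : ℕ → Vec d) (I : Finset ℕ)
    (v : Vec d) :
    v.ofLp ⬝ᵥ (∑ s ∈ I, α s • Matrix.vecMulVec (z s).ofLp (z s).ofLp
        + c • (1 : Matrix (Fin d) (Fin d) ℝ)) *ᵥ v.ofLp =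
      ∑ s ∈ I, α s * ⟪z s, v⟫ ^ 2 + c * ‖v‖ ^ 2 := by
  rw [Matrix.add_mulVec, dotProduct_add, Matrix.sum_mulVec, dotProduct_sum, Matrix.smul_mulVec,
    Matrix.one_mulVec, dotProduct_smul, norm_sq_eq_dotProduct, smul_eq_mul]
  congr 1
  refine Finset.sum_congr rfl fun s _ => ?_
  rw [Matrix.smul_mulVec, dotProduct_smul, dotProduct_vecMulVec_mulVec, inner_eq_dotProduct,
    smul_eq_mul]

lemma dotProduct_designMatrix_mulVec (lam : ℝ) (z : ℕ → Vec d) (t : ℕ) (θ v : Vec d) :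
    v.ofLp ⬝ᵥ designMatrix lam z t θ *ᵥ v.ofLp =
      ∑ s ∈ Finset.Ico 1 t, deriv Real.sigmoid ⟪z s, θ⟫ * ⟪z s, v⟫ ^ 2 + lam * ‖v‖ ^ 2 :=
  dotProduct_sum_smul_vecMulVec_mulVec _ _ _ _ _

lemma dotProduct_gram_mulVec (c : ℝ) (z : ℕ → Vec d) (t : ℕ) (v : Vec d) :
    v.ofLp ⬝ᵥ gram c z t *ᵥ v.ofLp = ∑ s ∈ Finset.Ico 1 t, ⟪z s, v⟫ ^ 2 + c * ‖v‖ ^ 2 := by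
  simpa [gram] using dotProduct_sum_smul_vecMulVec_mulVec c (fun _ => 1) z (Finset.Ico 1 t) v

lemma matNorm_sq {M : Matrix (Fin d) (Fin d) ℝ} (hM : M.PosDef) (v : Vec d) :
    matNorm M⁻¹ v ^ 2 = v.ofLp ⬝ᵥ M⁻¹ *ᵥ v.ofLp :=
  Real.sq_sqrt (inv_dotProduct_nonneg hM _)

/-- Since `κ σ' ≥ 1`, `κ` times the design matrix dominates the Gram matrix with regularizer `κ *
lam`. The Gram matrix does not depend on `θ`, so it grows by rank-one updates and its determinants
telescope although the estimate moves each round. -/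
lemma matNorm_designMatrix_inv_sq_le {lam κ : ℝ} (hlam : 0 < lam) (hκ : 0 < κ) (z : ℕ → Vec d)
    (t : ℕ) (θ v : Vec d)
    (h : ∀ s ∈ Finset.Ico 1 t, 1 ≤ κ * deriv Real.sigmoid ⟪z s, θ⟫) :
    matNorm (designMatrix lam z t θ)⁻¹ v ^ 2 ≤ κ * matNorm (gram (κ * lam) z t)⁻¹ v ^ 2 := by
  have hV := gram_posDef (mul_pos hκ hlam) z t
  have hH := designMatrix_posDef hlam z t θ
  rw [matNorm_sq hH, matNorm_sq hV]
  refine inv_dotProduct_le hV hH (fun u => ?_) _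
  have h1 := dotProduct_gram_mulVec (κ * lam) z t (WithLp.toLp 2 u)
  have h2 := dotProduct_designMatrix_mulVec lam z t θ (WithLp.toLp 2 u)
  simp only at h1 h2
  rw [h1, h2, mul_add, Finset.mul_sum, ← mul_assoc κ lam]
  gcongr with s hs
  rw [← mul_assoc]
  exact le_mul_of_one_le_left (sq_nonneg _) (h s hs)

lemma det_gram {c : ℝ} (hc : 0 < c) (z : ℕ → Vec d) {t : ℕ} (ht : 1 ≤ t) :
    (gram c z t).det = c ^ d * ∏ s ∈ Finset.Ico 1 t, (1 + matNorm (gram c z s)⁻¹ (z s) ^ 2) := by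
  induction t, ht using Nat.le_induction with
  | base => simp [gram]
  | succ t ht ih =>
    have e : gram c z (t + 1) = gram c z t + Matrix.vecMulVec (z t).ofLp (z t).ofLp := by
      rw [gram, gram, Finset.sum_Ico_succ_top ht, add_right_comm]
    rw [e, det_add_vecMulVec (gram_posDef hc z t), ih, Finset.prod_Ico_succ_top ht,
      matNorm_sq (gram_posDef hc z t), mul_assoc]

lemma trace_gram_le {c : ℝ} {z : ℕ → Vec d} {t T : ℕ} (ht : t ≤ T + 1)
    (hz : ∀ s ∈ Finset.Ico 1 t, ‖z s‖ ≤ 2) : (gram c z t).trace ≤ 4 * T + c * d := by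
  have e : (gram c z t).trace = ∑ s ∈ Finset.Ico 1 t, ‖z s‖ ^ 2 + c * d := by
    simp [gram, Matrix.trace_add, Matrix.trace_sum, Matrix.trace_vecMulVec, norm_sq_eq_dotProduct]
  rw [e]
  gcongr
  calc _ ≤ ∑ s ∈ Finset.Ico 1 t, (4 : ℝ) := by
        refine Finset.sum_le_sum fun s hs => ?_
        nlinarith [hz s hs, norm_nonneg (z s)]
    _ = 4 * ((t - 1 : ℕ) : ℝ) := by simp [mul_comm]
    _ ≤ _ := by
        gcongr
        omega

lemma min_one_le_two_mul_log {x : ℝ} (hx : 0 ≤ x) : min 1 x ≤ 2 * Real.log (1 + x) := by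
  have hm : 0 ≤ min 1 x := le_min zero_le_one hx
  have h1 : Real.log (1 + min 1 x) ≤ Real.log (1 + x) :=
    Real.log_le_log (by positivity) (by linarith [min_le_right 1 x])
  have h2 := Real.one_sub_inv_le_log_of_pos (show 0 < 1 + min 1 x by positivity)
  have h3 : min 1 x / 2 ≤ 1 - (1 + min 1 x)⁻¹ := by
    have : 1 - (1 + min 1 x)⁻¹ = min 1 x / (1 + min 1 x) := by field_simp; ring
    rw [this]
    gcongr
    linarith [min_le_left 1 x]
  linarith

/-- The elliptic potential lemma. -/
lemma sum_min_one_matNorm_sq_le (hd : 1 ≤ d) {c : ℝ} (hc : 0 < c) {z : ℕ → Vec d} {T : ℕ}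
    (hz : ∀ s ∈ Finset.Icc 1 T, ‖z s‖ ≤ 2) :
    ∑ t ∈ Finset.Icc 1 T, min 1 (matNorm (gram c z t)⁻¹ (z t) ^ 2) ≤
      2 * d * Real.log (1 + 4 * T / (c * d)) := by
  have hI : Finset.Icc 1 T = Finset.Ico 1 (T + 1) := by ext; simp
  rw [hI] at hz ⊢
  have : Nonempty (Fin d) := ⟨⟨0, hd⟩⟩
  have hd0 : (0 : ℝ) < d := by exact_mod_cast hd
  have hdet := det_gram hc z (t := T + 1) (by omega)
  have hle := det_le_trace_div_pow (gram_posDef hc z (T + 1)).posSemidef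
  have htr := trace_gram_le (c := c) le_rfl hz
  have hp : 0 < (gram c z (T + 1)).det := (gram_posDef hc z (T + 1)).det_pos
  have htn := (gram_posDef hc z (T + 1)).posSemidef.trace_nonneg
  rw [Fintype.card_fin] at hle
  have h1 : ∏ s ∈ Finset.Ico 1 (T + 1), (1 + matNorm (gram c z s)⁻¹ (z s) ^ 2) ≤
      (1 + 4 * T / (c * d)) ^ d := by
    have : (gram c z (T + 1)).det ≤ ((4 * T + c * d) / d) ^ d := hle.trans (by gcongr)
    rw [hdet] at this
    have e : (4 * T + c * d) / d = c * (1 + 4 * T / (c * d)) := by field_simp; ring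
    rw [e, mul_pow] at this
    exact le_of_mul_le_mul_left this (by positivity)
  calc _ ≤ ∑ t ∈ Finset.Ico 1 (T + 1), 2 * Real.log (1 + matNorm (gram c z t)⁻¹ (z t) ^ 2) :=
        Finset.sum_le_sum fun t _ => min_one_le_two_mul_log (sq_nonneg _)
    _ = 2 * Real.log (∏ t ∈ Finset.Ico 1 (T + 1), (1 + matNorm (gram c z t)⁻¹ (z t) ^ 2)) := by
        rw [Real.log_prod (fun t _ => by positivity), Finset.mul_sum]
    _ ≤ 2 * Real.log ((1 + 4 * T / (c * d)) ^ d) := by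
        gcongr
    _ = _ := by rw [Real.log_pow]; ring

/-! ### Confidence bound from likelihood ratios -/

section Confidence

variable {Ω : Type*} {θstar : Vec d} {z : ℕ → Ω → Vec d} {y : ℕ → Ω → ℝ}

/-- The likelihood ratio of `θ` and `θstar` after `t - 1` rounds. -/
noncomputable def likRatio (z : ℕ → Ω → Vec d) (y : ℕ → Ω → ℝ) (θstar θ : Vec d) (t : ℕ)
    (ω : Ω) : ℝ :=
  Real.exp (logLoss (fun s => z s ω) (fun s => y s ω) t θstar -
    logLoss (fun s => z s ω) (fun s => y s ω) t θ)

/-- The likelihood ratio of one label with feature difference `v`. -/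
noncomputable def labelRatio (θstar θ : Vec d) (c : ℝ) (v : Vec d) : ℝ :=
  Real.exp ((Real.log (1 + Real.exp ⟪v, θstar⟫) - c * ⟪v, θstar⟫)
    - (Real.log (1 + Real.exp ⟪v, θ⟫) - c * ⟪v, θ⟫))

lemma measurable_labelRatio (θstar θ : Vec d) (c : ℝ) : Measurable (labelRatio θstar θ c) := by
  have h (θ : Vec d) : Measurable fun v : Vec d => ⟪v, θ⟫ :=
    (by fun_prop : Continuous fun v : Vec d => ⟪v, θ⟫).measurable
  unfold labelRatio
  have := h θ
  have := h θstar
  fun_prop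

lemma abs_labelRatio_le (θ : Vec d) {c : ℝ} (h0 : 0 ≤ c) (h1 : c ≤ 1) {v : Vec d} (hv : ‖v‖ ≤ 2) :
    |labelRatio θstar θ c v| ≤ Real.exp (2 * ‖θstar - θ‖) := by
  rw [labelRatio, Real.abs_exp, Real.exp_le_exp]
  refine (log_one_add_exp_sub_mul_sub_le _ _ h0 h1).trans ?_
  rw [← inner_sub_right]
  refine (abs_real_inner_le_norm _ _).trans ?_
  gcongr

lemma labelRatio_zero (θ v : Vec d) :
    labelRatio θstar θ 0 v = (1 - Real.sigmoid ⟪v, θ⟫) / (1 - Real.sigmoid ⟪v, θstar⟫) := by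
  have h (w : ℝ) : 0 < 1 - Real.sigmoid w := by linarith [Real.sigmoid_lt_one w]
  rw [labelRatio, ← Real.exp_log (h ⟪v, θ⟫), ← Real.exp_log (h ⟪v, θstar⟫), ← Real.exp_sub,
    log_one_sub_sigmoid, log_one_sub_sigmoid]
  congr 1
  ring

lemma labelRatio_one (θ v : Vec d) :
    labelRatio θstar θ 1 v = Real.sigmoid ⟪v, θ⟫ / Real.sigmoid ⟪v, θstar⟫ := by
  rw [labelRatio, ← Real.exp_log (Real.sigmoid_pos ⟪v, θ⟫),
    ← Real.exp_log (Real.sigmoid_pos ⟪v, θstar⟫), ← Real.exp_sub, log_sigmoid, log_sigmoid]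
  congr 1
  ring

/-- The mean of the one-label ratio under the true Bernoulli law is the total mass of the law with
parameter `θ`. -/
lemma labelRatio_mean (θ v : Vec d) :
    labelRatio θstar θ 0 v +
      (labelRatio θstar θ 1 v - labelRatio θstar θ 0 v) * Real.sigmoid ⟪v, θstar⟫ = 1 := by
  rw [labelRatio_zero, labelRatio_one]
  have h1 := (Real.sigmoid_pos ⟪v, θstar⟫).ne'
  have h2 : 1 - Real.sigmoid ⟪v, θstar⟫ ≠ 0 := by linarith [Real.sigmoid_lt_one ⟪v, θstar⟫]
  field_simp
  ring

/-- A binary label lets the new factor be written as an affine function of `y t`, so only the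
conditional mean of the label matters. -/
lemma likRatio_succ {θ : Vec d} {t : ℕ} (ht : 1 ≤ t) {ω : Ω} (hy : y t ω = 0 ∨ y t ω = 1) :
    likRatio z y θstar θ (t + 1) ω =
      likRatio z y θstar θ t ω * labelRatio θstar θ 0 (z t ω) +
        likRatio z y θstar θ t ω *
          (labelRatio θstar θ 1 (z t ω) - labelRatio θstar θ 0 (z t ω)) * y t ω := by
  have e : likRatio z y θstar θ (t + 1) ω =
      likRatio z y θstar θ t ω * labelRatio θstar θ (y t ω) (z t ω) := by
    simp only [likRatio, labelRatio, logLoss_eq, ← Real.exp_add, Finset.sum_Ico_succ_top ht]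
    congr 1
    ring
  rw [e]
  rcases hy with h | h <;> rw [h] <;> ring

variable [mΩ : MeasurableSpace Ω]

/-- The feature differences `z` and the labels `y` of `T` rounds of preference feedback from the
Bradley-Terry-Luce model with parameter `θstar`. -/
structure IsFeedback (μ : Measure Ω) (ℱ : Filtration ℕ mΩ) (θstar : Vec d) (T : ℕ)
    (z : ℕ → Ω → Vec d) (y : ℕ → Ω → ℝ) : Prop where
  norm_le : ∀ t ∈ Finset.Icc 1 T, ∀ ω, ‖z t ω‖ ≤ 2
  adapted : ∀ t ∈ Finset.Icc 1 T, Measurable[ℱ t] (z t)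
  label_binary : ∀ t ∈ Finset.Icc 1 T, ∀ ω, y t ω = 0 ∨ y t ω = 1
  label_adapted : ∀ t ∈ Finset.Icc 1 T, Measurable[ℱ (t + 1)] (y t)
  label_law : ∀ t ∈ Finset.Icc 1 T,
    μ[y t | ℱ t] =ᵐ[μ] fun ω => Real.sigmoid ⟪z t ω, θstar⟫

variable {μ : Measure Ω} {ℱ : Filtration ℕ mΩ} {T : ℕ}

lemma IsFeedback.measurable_logLoss (hf : IsFeedback μ ℱ θstar T z y) {t : ℕ} (ht : t ≤ T + 1)
    (θ : Vec d) :
    Measurable[ℱ t] fun ω => logLoss (fun s => z s ω) (fun s => y s ω) t θ := by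
  simp only [logLoss_eq]
  refine Finset.measurable_fun_sum _ fun s hs => ?_
  have hs' : s ∈ Finset.Icc 1 T := by simp at hs ⊢; omega
  have hst : s + 1 ≤ t := by simp at hs; omega
  have hw : Measurable[ℱ t] fun ω => ⟪z s ω, θ⟫ :=
    (by fun_prop : Continuous fun v : Vec d => ⟪v, θ⟫).measurable.comp
      ((hf.adapted s hs').mono (ℱ.mono (by omega)) le_rfl)
  have hy : Measurable[ℱ t] (y s) := (hf.label_adapted s hs').mono (ℱ.mono hst) le_rfl
  exact (Real.measurable_log.comp ((Real.measurable_exp.comp hw).const_add 1)).sub (hy.mul hw)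

lemma IsFeedback.measurable_likRatio (hf : IsFeedback μ ℱ θstar T z y) {t : ℕ} (ht : t ≤ T + 1)
    (θ : Vec d) : Measurable[ℱ t] (likRatio z y θstar θ t) :=
  Real.measurable_exp.comp ((hf.measurable_logLoss ht θstar).sub (hf.measurable_logLoss ht θ))

lemma IsFeedback.logLoss_sub_le (hf : IsFeedback μ ℱ θstar T z y) {t : ℕ} (ht : t ≤ T + 1)
    (θ θ' : Vec d) (ω : Ω) :
    logLoss (fun s => z s ω) (fun s => y s ω) t θ - logLoss (fun s => z s ω) (fun s => y s ω) t θ'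
      ≤ 2 * T * ‖θ - θ'‖ := by
  have hs' : ∀ s ∈ Finset.Ico 1 t, s ∈ Finset.Icc 1 T := fun s hs => by simp at hs ⊢; omega
  exact APO.logLoss_sub_le ht (fun s hs => hf.norm_le s (hs' s hs) ω)
    (fun s hs => hf.label_binary s (hs' s hs) ω) θ θ'

lemma IsFeedback.abs_likRatio_le (hf : IsFeedback μ ℱ θstar T z y) {t : ℕ} (ht : t ≤ T + 1)
    (θ : Vec d) (ω : Ω) :
    |likRatio z y θstar θ t ω| ≤ Real.exp (2 * T * ‖θstar - θ‖) := by
  rw [likRatio, Real.abs_exp]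
  exact Real.exp_le_exp.2 (hf.logLoss_sub_le ht _ _ _)

/-- The likelihood ratio has expectation one. -/
lemma IsFeedback.integral_likRatio [IsProbabilityMeasure μ] (hf : IsFeedback μ ℱ θstar T z y)
    (θ : Vec d) {t : ℕ} (ht1 : 1 ≤ t) (ht : t ≤ T + 1) :
    ∫ ω, likRatio z y θstar θ t ω ∂μ = 1 := by
  induction t, ht1 using Nat.le_induction with
  | base => simp [likRatio, logLoss]
  | succ t ht1 ih =>
    have htT : t ∈ Finset.Icc 1 T := by simp; omega
    have hM : Measurable[ℱ t] (likRatio z y θstar θ t) := hf.measurable_likRatio (by omega) θ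
    have hr (c : ℝ) : Measurable[ℱ t] fun ω => labelRatio θstar θ c (z t ω) :=
      (measurable_labelRatio θstar θ c).comp (hf.adapted t htT)
    set G : Ω → ℝ := fun ω => likRatio z y θstar θ t ω * labelRatio θstar θ 0 (z t ω) with hG
    set K : Ω → ℝ := fun ω => likRatio z y θstar θ t ω *
      (labelRatio θstar θ 1 (z t ω) - labelRatio θstar θ 0 (z t ω)) with hK
    have hGm : Measurable[ℱ t] G := hM.mul (hr 0)
    have hKm : Measurable[ℱ t] K := hM.mul ((hr 1).sub (hr 0))
    have hym : Measurable (y t) := (hf.label_adapted t htT).mono (ℱ.le _) le_rfl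
    set B := Real.exp (2 * T * ‖θstar - θ‖)
    set b := Real.exp (2 * ‖θstar - θ‖)
    have hB (ω) : |likRatio z y θstar θ t ω| ≤ B := hf.abs_likRatio_le (by omega) θ ω
    have hb0 (ω) : |labelRatio θstar θ 0 (z t ω)| ≤ b :=
      abs_labelRatio_le θ le_rfl zero_le_one (hf.norm_le t htT ω)
    have hb1 (ω) : |labelRatio θstar θ 1 (z t ω)| ≤ b :=
      abs_labelRatio_le θ zero_le_one le_rfl (hf.norm_le t htT ω)
    have hGb (ω) : ‖G ω‖ ≤ B * b := by
      rw [Real.norm_eq_abs, hG, abs_mul]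
      exact mul_le_mul (hB ω) (hb0 ω) (abs_nonneg _) (Real.exp_nonneg _)
    have hKb (ω) : ‖K ω‖ ≤ B * (b + b) := by
      rw [Real.norm_eq_abs, hK, abs_mul]
      exact mul_le_mul (hB ω) ((abs_sub _ _).trans (add_le_add (hb1 ω) (hb0 ω))) (abs_nonneg _)
        (Real.exp_nonneg _)
    have hyb (ω) : ‖y t ω‖ ≤ 1 := by rcases hf.label_binary t htT ω with h | h <;> simp [h]
    have hGi : Integrable G μ :=
      .of_bound (hGm.mono (ℱ.le _) le_rfl).aestronglyMeasurable _ (.of_forall hGb)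
    have hyi : Integrable (y t) μ := .of_bound hym.aestronglyMeasurable _ (.of_forall hyb)
    have hKy : Integrable (K * y t) μ := by
      refine .of_bound ((hKm.mono (ℱ.le _) le_rfl).mul hym).aestronglyMeasurable (B * (b + b) * 1)
        (.of_forall fun ω => ?_)
      rw [Pi.mul_apply, norm_mul]
      exact mul_le_mul (hKb ω) (hyb ω) (norm_nonneg _) ((norm_nonneg _).trans (hKb ω))
    have hpull : μ[K * y t | ℱ t] =ᵐ[μ] fun ω => K ω * Real.sigmoid ⟪z t ω, θstar⟫ := by
      filter_upwards [condExp_mul_of_stronglyMeasurable_left hKm.stronglyMeasurable hKy hyi,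
        hf.label_law t htT] with ω h1 h2
      rw [h1, Pi.mul_apply, h2]
    calc ∫ ω, likRatio z y θstar θ (t + 1) ω ∂μ = ∫ ω, (G ω + (K * y t) ω) ∂μ := by
          congr 1 with ω
          exact likRatio_succ ht1 (hf.label_binary t htT ω)
      _ = ∫ ω, G ω ∂μ + ∫ ω, (K * y t) ω ∂μ := integral_add hGi hKy
      _ = ∫ ω, G ω ∂μ + ∫ ω, K ω * Real.sigmoid ⟪z t ω, θstar⟫ ∂μ := by
          rw [← integral_condExp (ℱ.le t) (f := K * y t), integral_congr_ae hpull]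
      _ = ∫ ω, (G ω + K ω * Real.sigmoid ⟪z t ω, θstar⟫) ∂μ :=
          (integral_add hGi ((integrable_congr hpull).1 integrable_condExp)).symm
      _ = ∫ ω, likRatio z y θstar θ t ω ∂μ := by
          congr 1 with ω
          rw [hG, hK]
          linear_combination likRatio z y θstar θ t ω * labelRatio_mean (θstar := θstar) θ (z t ω)
      _ = 1 := ih (by omega)

/-- Markov's inequality for the likelihood ratio. -/
lemma IsFeedback.measureReal_likRatio_ge_le [IsProbabilityMeasure μ]
    (hf : IsFeedback μ ℱ θstar T z y) (θ : Vec d) {t : ℕ} (ht1 : 1 ≤ t) (ht : t ≤ T + 1) {c : ℝ}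
    (hc : 0 < c) : μ.real {ω | c ≤ likRatio z y θstar θ t ω} ≤ 1 / c := by
  have hi : Integrable (likRatio z y θstar θ t) μ :=
    .of_bound ((hf.measurable_likRatio ht θ).mono (ℱ.le _) le_rfl).aestronglyMeasurable _
      (.of_forall fun ω => hf.abs_likRatio_le ht θ ω)
  have h := mul_meas_ge_le_integral_of_nonneg (f := likRatio z y θstar θ t)
    (.of_forall fun ω => Real.exp_nonneg _) hi c
  rw [hf.integral_likRatio θ ht1 ht] at h
  rw [le_div_iff₀ hc, mul_comm]
  exact h

/-- A confidence bound on the log-loss of the true parameter, uniform over rounds and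
parameters. -/
lemma IsFeedback.exists_confidence [IsProbabilityMeasure μ] (hf : IsFeedback μ ℱ θstar T z y)
    (hd : 1 ≤ d) (hT : 1 ≤ T) {S δ : ℝ} (hS : 0 ≤ S) (hδ : 0 < δ) :
    ∃ E : Set Ω, MeasurableSet E ∧ 1 - δ ≤ μ.real E ∧
      ∀ ω ∈ E, ∀ t ∈ Finset.Icc 1 T, ∀ θ : Vec d, ‖θ‖ ≤ S →
        logLoss (fun s => z s ω) (fun s => y s ω) t θstar -
            logLoss (fun s => z s ω) (fun s => y s ω) t θ ≤
          Real.log (T / δ) + d * Real.log (1 + 2 * (S * T / d)) + 2 * d := by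
  have hd0 : (0 : ℝ) < d := by exact_mod_cast hd
  have hT0 : (0 : ℝ) < T := by exact_mod_cast hT
  -- The loss is `2 T`-Lipschitz, so mesh `d / T` costs only `2 d` in the bound.
  obtain ⟨N, -, hcover, hcard⟩ := exists_net (E := Vec d) hS (show (0 : ℝ) < d / T by positivity)
  rw [finrank_euclideanSpace_fin] at hcard
  have eK : 1 + 2 * S / (d / T) = 1 + 2 * (S * T / d) := by field_simp
  rw [eK] at hcard
  set K := (1 + 2 * (S * T / d)) ^ d with hKdef
  have hK : 0 < K := by positivity
  -- Each of at most `T * K` events has probability at most `1 / c`, so their total is at most `δ`.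
  set c := T / δ * K with hc
  have hc0 : 0 < c := by positivity
  set bad : Set Ω := ⋃ p ∈ Finset.Icc 1 T ×ˢ N, {ω | c ≤ likRatio z y θstar p.2 p.1 ω} with hbad
  have hle {t : ℕ} (ht : t ∈ Finset.Icc 1 T) : 1 ≤ t ∧ t ≤ T + 1 := by simp at ht; omega
  have hbadm : MeasurableSet bad := by
    refine Finset.measurableSet_biUnion _ fun p hp => ?_
    have ht := hle (Finset.mem_product.1 hp).1
    exact measurableSet_le measurable_const
      ((hf.measurable_likRatio ht.2 p.2).mono (ℱ.le _) le_rfl)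
  have hbadle : μ.real bad ≤ δ := by
    calc μ.real bad ≤ ∑ p ∈ Finset.Icc 1 T ×ˢ N, μ.real {ω | c ≤ likRatio z y θstar p.2 p.1 ω} :=
          measureReal_biUnion_finset_le _ _
      _ ≤ ∑ p ∈ Finset.Icc 1 T ×ˢ N, 1 / c := by
          refine Finset.sum_le_sum fun p hp => ?_
          have ht := hle (Finset.mem_product.1 hp).1
          exact hf.measureReal_likRatio_ge_le p.2 ht.1 ht.2 hc0
      _ = T * N.card * (1 / c) := by simp
      _ ≤ T * K * (1 / c) := by gcongr
      _ = δ := by rw [hc]; field_simp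
  refine ⟨badᶜ, hbadm.compl, ?_, fun ω hω t ht θ hθ => ?_⟩
  · rw [probReal_compl_eq_one_sub hbadm]
    linarith
  · obtain ⟨e, heN, he⟩ := hcover θ hθ
    have h1 := hf.logLoss_sub_le (hle ht).2 e θ ω
    have h2 : 2 * T * ‖e - θ‖ ≤ 2 * d := by
      calc 2 * T * ‖e - θ‖ ≤ 2 * T * (d / T) := by gcongr
        _ = 2 * d := by field_simp
    have h3 : likRatio z y θstar e t ω < c := by
      by_contra! hcon
      exact hω (Set.mem_biUnion (Finset.mk_mem_product ht heN) hcon)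
    have h4 := Real.log_lt_log (Real.exp_pos _) h3
    rw [Real.log_exp, hc, Real.log_mul (by positivity) (by positivity), hKdef, Real.log_pow] at h4
    linarith

end Confidence

/-! ### The non-linearity parameter -/

section Kappa

variable {X A : Type*} {φ : X → A → Vec d} {S : ℝ}

lemma one_div_deriv_sigmoid (w : ℝ) :
    1 / deriv Real.sigmoid w = 2 + Real.exp w + Real.exp (-w) := by
  have h := Real.exp_pos w
  rw [Real.deriv_sigmoid]
  simp only
  rw [one_sub_sigmoid, sigmoid_eq_exp_mul, Real.exp_neg]
  field_simp
  ring

lemma norm_feature_sub_le (hφ : ∀ x a, ‖φ x a‖ ≤ 1) (x : X) (a a' : A) :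
    ‖φ x a - φ x a'‖ ≤ 2 := by
  linarith [norm_sub_le (φ x a) (φ x a'), hφ x a, hφ x a']

lemma one_div_deriv_sigmoid_le_kappa (hφ : ∀ x a, ‖φ x a‖ ≤ 1) (x : X) (a a' : A) {θ : Vec d}
    (hθ : θ ∈ paramSet d S) :
    1 / deriv Real.sigmoid ⟪φ x a - φ x a', θ⟫ ≤ kappa φ S := by
  rw [inner_sub_left]
  refine le_ciSup (f := fun p : X × A × A × paramSet d S => 1 / deriv Real.sigmoid
      (⟪φ p.1 p.2.1, (p.2.2.2 : Vec d)⟫ - ⟪φ p.1 p.2.2.1, (p.2.2.2 : Vec d)⟫)) ?_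
      (x, a, a', ⟨θ, hθ⟩)
  -- Boundedness is needed: a real `⨆` over an unbounded family takes the default value `0`.
  refine ⟨2 + Real.exp (2 * S) + Real.exp (2 * S), ?_⟩
  rintro _ ⟨⟨x, a, a', θ, hθ⟩, rfl⟩
  simp only
  rw [one_div_deriv_sigmoid, ← inner_sub_left]
  have h : |⟪φ x a - φ x a', θ⟫| ≤ 2 * S :=
    (abs_real_inner_le_norm _ _).trans
      (mul_le_mul (norm_feature_sub_le hφ x a a') hθ.2 (norm_nonneg _) (by norm_num))
  have := abs_le.1 h
  gcongr <;> linarith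

lemma one_le_kappa_mul_deriv_sigmoid (hφ : ∀ x a, ‖φ x a‖ ≤ 1) (x : X) (a a' : A) {θ : Vec d}
    (hθ : θ ∈ paramSet d S) :
    1 ≤ kappa φ S * deriv Real.sigmoid ⟪φ x a - φ x a', θ⟫ := by
  have h := one_div_deriv_sigmoid_le_kappa hφ x a a' hθ
  rwa [div_le_iff₀ (deriv_sigmoid_pos _)] at h

lemma four_le_kappa [Nonempty X] [Nonempty A] (hS : 0 ≤ S) (hφ : ∀ x a, ‖φ x a‖ ≤ 1) :
    4 ≤ kappa φ S := by
  obtain ⟨x⟩ := ‹Nonempty X›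
  obtain ⟨a⟩ := ‹Nonempty A›
  have h := one_div_deriv_sigmoid_le_kappa hφ x a a (θ := 0) (S := S) ⟨by simp, by simpa using hS⟩
  rw [one_div_deriv_sigmoid] at h
  simp at h
  linarith

end Kappa

/-! ### Estimation error and its average over rounds -/

/-- The estimation error in the norm of the design matrix, in terms of a bound on the log-loss
of the true parameter. -/
lemma designMatrix_error_le {z : ℕ → Vec d} {y : ℕ → ℝ} {t : ℕ} {S lam β : ℝ}
    {θ θstar : Vec d} (hS : 0 ≤ S) (hlam : 0 ≤ lam) (hz : ∀ s ∈ Finset.Ico 1 t, ‖z s‖ ≤ 2)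
    (hθ : θ ∈ paramSet d S) (hθstar : θstar ∈ paramSet d S)
    (hmin : IsMinOn (logLoss z y t) (paramSet d S) θ)
    (hβ : logLoss z y t θstar - logLoss z y t θ ≤ β) :
    (θstar - θ).ofLp ⬝ᵥ designMatrix lam z t θ *ᵥ (θstar - θ).ofLp ≤
      (2 + 4 * S) * β + lam * (2 * S) ^ 2 := by
  have hn : ‖θstar - θ‖ ≤ 2 * S := by linarith [norm_sub_le θstar θ, hθ.2, hθstar.2]
  have h1 := logLoss_sub_ge z y t θ θstar
  have h2 := logLoss_gradient_nonneg hθ hθstar hmin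
  rw [dotProduct_designMatrix_mulVec]
  have h3 : ∑ s ∈ Finset.Ico 1 t, deriv Real.sigmoid ⟪z s, θ⟫ * ⟪z s, θstar - θ⟫ ^ 2 ≤
      (2 + 4 * S) * ∑ s ∈ Finset.Ico 1 t,
        deriv Real.sigmoid ⟪z s, θ⟫ * ⟪z s, θstar - θ⟫ ^ 2 / (2 + |⟪z s, θstar - θ⟫|) := by
    rw [Finset.mul_sum]
    refine Finset.sum_le_sum fun s hs => ?_
    -- The self-concordance denominators `2 + |⟪z s, θstar - θ⟫|` are thus at most `2 + 4 * S`.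
    have hu : |⟪z s, θstar - θ⟫| ≤ 4 * S :=
      (abs_real_inner_le_norm _ _).trans (by nlinarith [hz s hs, norm_nonneg (z s)])
    have hp : 0 ≤ deriv Real.sigmoid ⟪z s, θ⟫ * ⟪z s, θstar - θ⟫ ^ 2 :=
      mul_nonneg (deriv_sigmoid_pos _).le (sq_nonneg _)
    rw [← mul_div_assoc, le_div_iff₀ (by positivity), mul_comm]
    exact mul_le_mul_of_nonneg_right (by linarith) hp
  have h4 : (2 + 4 * S) * ∑ s ∈ Finset.Ico 1 t,
      deriv Real.sigmoid ⟪z s, θ⟫ * ⟪z s, θstar - θ⟫ ^ 2 / (2 + |⟪z s, θstar - θ⟫|) ≤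
      (2 + 4 * S) * β := by
    gcongr
    linarith
  have h5 : lam * ‖θstar - θ‖ ^ 2 ≤ lam * (2 * S) ^ 2 := by gcongr
  linarith

/-- The error of the averaged estimate in a direction `w` that is no more uncertain than the
explored feature differences. -/
lemma inner_error_avgParam_le (hd : 1 ≤ d) {T : ℕ} (hT : 1 ≤ T) {z θhat : ℕ → Vec d}
    {θstar w : Vec d} {S lam κ ρ D : ℝ} (hlam : 0 < lam) (hκ : 0 < κ)
    (hz : ∀ t ∈ Finset.Icc 1 T, ‖z t‖ ≤ 2) (hw : ‖w‖ ≤ 2)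
    (hκz : ∀ t ∈ Finset.Icc 1 T, ∀ s ∈ Finset.Icc 1 T,
      1 ≤ κ * deriv Real.sigmoid ⟪z s, θhat t⟫)
    (hsel : ∀ t ∈ Finset.Icc 1 T, matNorm (designMatrix lam z t (θhat t))⁻¹ w ≤
      matNorm (designMatrix lam z t (θhat t))⁻¹ (z t))
    (hS : ∀ t ∈ Finset.Icc 1 T, ‖θstar - θhat t‖ ≤ 2 * S)
    (hρ : ∀ t ∈ Finset.Icc 1 T, (θstar - θhat t).ofLp ⬝ᵥ
      designMatrix lam z t (θhat t) *ᵥ (θstar - θhat t).ofLp ≤ ρ)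
    (hD0 : 0 ≤ D) (hDS : (4 * S) ^ 2 ≤ D) (hDρ : ρ * κ ≤ D) :
    ⟪w, θstar - avgParam T θhat⟫ ≤
      Real.sqrt (D * (2 * d * Real.log (1 + 4 * T / (κ * lam * d))) / T) := by
  have hT0 : (0 : ℝ) < T := by exact_mod_cast hT
  have hc : 0 < κ * lam := mul_pos hκ hlam
  -- The bonus may exceed one, so the crude bound `4 * S` on the inner product supplies the cap that
  -- the elliptic potential lemma needs.
  have hterm : ∀ t ∈ Finset.Icc 1 T, ⟪w, θstar - θhat t⟫ ^ 2 ≤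
      D * min 1 (matNorm (gram (κ * lam) z t)⁻¹ (z t) ^ 2) := by
    intro t ht
    rw [mul_min_of_nonneg _ _ hD0]
    refine le_min ?_ ?_
    · have h := abs_real_inner_le_norm w (θstar - θhat t)
      have h' : |⟪w, θstar - θhat t⟫| ≤ 4 * S :=
        h.trans (by nlinarith [hS t ht, norm_nonneg w, norm_nonneg (θstar - θhat t)])
      rw [mul_one]
      refine le_trans ?_ hDS
      rw [← sq_abs]
      gcongr
    · have hH := designMatrix_posDef hlam z t (θhat t)
      have h1 := dotProduct_sq_le_inv hH w.ofLp (θstar - θhat t).ofLp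
      rw [← inner_eq_dotProduct, ← matNorm_sq hH] at h1
      have h2 := matNorm_designMatrix_inv_sq_le hlam hκ z t (θhat t) (z t) fun s hs =>
        hκz t ht s (by simp at hs ht ⊢; omega)
      have h3 : matNorm (designMatrix lam z t (θhat t))⁻¹ w ^ 2 ≤
          matNorm (designMatrix lam z t (θhat t))⁻¹ (z t) ^ 2 := by
        have : 0 ≤ matNorm (designMatrix lam z t (θhat t))⁻¹ w := Real.sqrt_nonneg _
        gcongr
        exact hsel t ht
      have hρ0 : 0 ≤ ρ := le_trans (by
        simpa using hH.posSemidef.dotProduct_mulVec_nonneg (θstar - θhat t).ofLp) (hρ t ht)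
      calc _ ≤ _ := h1
        _ ≤ (κ * matNorm (gram (κ * lam) z t)⁻¹ (z t) ^ 2) * ρ :=
          mul_le_mul (h3.trans h2) (hρ t ht)
            (by simpa using hH.posSemidef.dotProduct_mulVec_nonneg (θstar - θhat t).ofLp)
            (by positivity)
        _ = (ρ * κ) * matNorm (gram (κ * lam) z t)⁻¹ (z t) ^ 2 := by ring
        _ ≤ _ := by gcongr
  have havg : ⟪w, θstar - avgParam T θhat⟫ = (∑ t ∈ Finset.Icc 1 T, ⟪w, θstar - θhat t⟫) / T := by
    simp only [inner_sub_right, avgParam, inner_smul_right, inner_sum, Finset.sum_sub_distrib]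
    simp
    field_simp
  have hcs := sq_sum_le_card_mul_sum_sq (s := Finset.Icc 1 T) (f := fun t => ⟪w, θstar - θhat t⟫)
  rw [Nat.card_Icc, Nat.add_sub_cancel] at hcs
  apply Real.le_sqrt_of_sq_le
  rw [havg, div_pow, div_le_div_iff₀ (by positivity) hT0]
  calc (∑ t ∈ Finset.Icc 1 T, ⟪w, θstar - θhat t⟫) ^ 2 * T
      ≤ (T * ∑ t ∈ Finset.Icc 1 T, ⟪w, θstar - θhat t⟫ ^ 2) * T := by gcongr
    _ ≤ (T * (D * (2 * d * Real.log (1 + 4 * T / (κ * lam * d))))) * T := by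
        gcongr
        refine (Finset.sum_le_sum hterm).trans ?_
        rw [← Finset.mul_sum]
        exact mul_le_mul_of_nonneg_left (sum_min_one_matNorm_sq_le hd hc hz) hD0
    _ = _ := by ring

/-! ### Numerical estimates for the rate -/

lemma log_one_add_four_mul_le {u : ℝ} (hu : 0 ≤ u) :
    Real.log (1 + 4 * u) ≤ 4 * Real.log (1 + u) := by
  have h : Real.log ((1 + u) ^ 4) = 4 * Real.log (1 + u) := by rw [Real.log_pow]; norm_num
  rw [← h]
  apply Real.log_le_log (by positivity)
  nlinarith [pow_nonneg hu 2, pow_nonneg hu 3, pow_nonneg hu 4]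

lemma half_le_log_div {T : ℕ} {δ : ℝ} (hT : 2 ≤ T) (hδ : 0 < δ) (hδ1 : δ ≤ 1) :
    1 / 2 ≤ Real.log (T / δ) := by
  have hT2 : (2 : ℝ) ≤ T := by exact_mod_cast hT
  have h1 : Real.log 2 ≤ Real.log (T / δ) := by
    apply Real.log_le_log (by norm_num)
    rw [le_div_iff₀ hδ]
    nlinarith
  linarith [Real.log_two_gt_d9]

/-- The radicand of the rate is bounded below when the number of rounds is small. -/
lemma quarter_le_rate_of_small {T : ℕ} {S lam κ B : ℝ} (hd : 1 ≤ d) (hT : 1 ≤ T) (hS : 1 ≤ S)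
    (hlam : 0 < lam) (hlam1 : lam ≤ 1) (hκ : 4 ≤ κ) (hB : 1 / 2 ≤ B) (hST : S * T < 3 * d) :
    1 / 4 ≤ B * Real.log (1 + T / (lam * κ * d)) * (κ * d / T) := by
  have hd0 : (0 : ℝ) < d := by exact_mod_cast hd
  have hT0 : (0 : ℝ) < T := by exact_mod_cast hT
  have hκ0 : 0 < κ := by linarith
  set u := κ * d / T with hu
  have hu1 : 1 ≤ u := by
    rw [hu, le_div_iff₀ hT0]
    nlinarith only [hST, hS, hT0, hκ, hd0]
  have e : T / (lam * κ * d) = (lam * u)⁻¹ := by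
    rw [hu]; field_simp
  have hlu : 0 < lam * u := by positivity
  have h1 := Real.one_sub_inv_le_log_of_pos (show 0 < 1 + (lam * u)⁻¹ by positivity)
  -- Here `lam ≤ 1` and `1 ≤ u` give `1 + lam * u ≤ 2 * u`.
  have h2 : 1 / (2 * u) ≤ 1 - (1 + (lam * u)⁻¹)⁻¹ := by
    have : 1 - (1 + (lam * u)⁻¹)⁻¹ = 1 / (1 + lam * u) := by field_simp; ring
    rw [this]
    apply one_div_le_one_div_of_le (by positivity)
    nlinarith
  rw [e]
  have h3 : 1 / 2 ≤ Real.log (1 + (lam * u)⁻¹) * u := by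
    have : 1 / (2 * u) * u ≤ Real.log (1 + (lam * u)⁻¹) * u := by gcongr; linarith
    have e2 : 1 / (2 * u) * u = 1 / 2 := by field_simp
    linarith
  rw [mul_assoc]
  nlinarith

/-- The confidence radius after many rounds. -/
lemma confidence_radius_le {T : ℕ} {S δ : ℝ} (hd : 1 ≤ d) (hlog : 0 ≤ Real.log (T / δ))
    (hST : 3 * d ≤ S * T) :
    Real.log (T / δ) + d * Real.log (1 + 2 * (S * T / d)) + 2 * d ≤
      5 * (d * Real.log (S * T / d) + Real.log (T / δ)) := by
  have hd0 : (0 : ℝ) < d := by exact_mod_cast hd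
  have hr : 3 ≤ S * T / d := by rwa [le_div_iff₀ hd0]
  set r := S * T / d
  have hr0 : 0 < r := by linarith
  -- As `3 > e`, the logarithm is at least one and can absorb the term `2 * d`.
  have h1 : 1 ≤ Real.log r := by
    rw [Real.le_log_iff_exp_le hr0]
    linarith [Real.exp_one_lt_d9]
  have h2 : Real.log (1 + 2 * r) ≤ 2 * Real.log r := by
    have : Real.log (r ^ 2) = 2 * Real.log r := by rw [Real.log_pow]; norm_num
    rw [← this]
    apply Real.log_le_log (by positivity)
    nlinarith
  nlinarith

lemma le_rpow_three_halves {S : ℝ} (hS : 1 ≤ S) : S ≤ S ^ (3 / 2 : ℝ) := by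
  simpa using Real.rpow_le_rpow_of_exponent_le hS (show (1 : ℝ) ≤ 3 / 2 by norm_num)

/-- The logarithmic factors of the rate, simplified. -/
lemma sqrt_rate_le {T : ℕ} {S lam κ δ : ℝ} (hd : 1 ≤ d) (hT : 2 ≤ T) (hS : 1 ≤ S)
    (hδ : 0 < δ) (hδ1 : δ ≤ 1) (hκ : 4 ≤ κ)
    (hlam : lam = 1 / (4 * S ^ 2 * (2 + 2 * S) ^ 2)) :
    Real.sqrt ((d * Real.log (S * T / d) + Real.log (T / δ))
        * Real.log (1 + T / (lam * κ * d)) * (κ * d / T)) ≤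
      4 * d * Real.sqrt (κ / T) * Real.log (S * T / δ) := by
  have hd1 : (1 : ℝ) ≤ d := by exact_mod_cast hd
  have hT2 : (2 : ℝ) ≤ T := by exact_mod_cast hT
  have hST : 2 ≤ S * T := by nlinarith only [hS, hT2]
  have hκ0 : 0 < κ := by linarith
  have hS0 : 0 < S := by linarith
  have hT0 : (0 : ℝ) < T := by linarith
  have hlogT := half_le_log_div hT hδ hδ1
  set l := Real.log (S * T / δ) with hl
  have hle : S * T ≤ S * T / δ := by
    rw [le_div_iff₀ hδ]; nlinarith only [hST, hδ1]
  have h0 : 0 ≤ Real.log (S * T) := Real.log_nonneg (by linarith)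
  have h1 : Real.log (S * T) ≤ l := Real.log_le_log (by positivity) hle
  have h2 : Real.log (S * T / d) ≤ l := by
    refine (Real.log_le_log (by positivity) ?_).trans h1
    exact div_le_self (by positivity) hd1
  have h3 : Real.log (T / δ) ≤ l := by
    apply Real.log_le_log (by positivity)
    gcongr
    nlinarith only [hS, hT2]
  have hl0 : 0 ≤ l := h0.trans h1
  have h4 : Real.log (1 + T / (lam * κ * d)) ≤ 6 * l := by
    have e : T / (lam * κ * d) = T * (16 * S ^ 2 * (1 + S) ^ 2) / (κ * d) := by
      rw [hlam]; field_simp; ring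
    have hle1 : T / (lam * κ * d) ≤ 16 * S ^ 4 * T := by
      rw [e, div_le_iff₀ (by positivity)]
      have a1 : (1 + S) ^ 2 ≤ 4 * S ^ 2 := by nlinarith only [hS]
      have a2 : 4 ≤ κ * d := by nlinarith only [hκ, hd1]
      calc T * (16 * S ^ 2 * (1 + S) ^ 2) ≤ T * (16 * S ^ 2 * (4 * S ^ 2)) := by gcongr
        _ = 16 * S ^ 4 * T * 4 := by ring
        _ ≤ 16 * S ^ 4 * T * (κ * d) := by gcongr
    -- Five of the factors `T ≥ 2` absorb the numerical constant, since `17 ≤ 2 ^ 5`.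
    have hle2 : 1 + 16 * S ^ 4 * T ≤ (S * T) ^ 6 := by
      have b1 : (1 : ℝ) ≤ S ^ 4 * T := by nlinarith only [one_le_pow₀ hS (n := 4), hT2]
      have b2 : (2 : ℝ) ^ 5 ≤ T ^ 5 := by gcongr
      have b3 : (1 : ℝ) ≤ S ^ 2 := one_le_pow₀ hS
      calc 1 + 16 * S ^ 4 * T ≤ S ^ 4 * T * (1 * 2 ^ 5) := by nlinarith only [b1]
        _ ≤ S ^ 4 * T * (S ^ 2 * T ^ 5) := by gcongr
        _ = _ := by ring
    have hpos : 0 ≤ T / (lam * κ * d) := by rw [e]; positivity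
    calc _ ≤ Real.log ((S * T) ^ 6) := Real.log_le_log (by positivity) (by linarith)
      _ = 6 * Real.log (S * T) := by rw [Real.log_pow]; norm_num
      _ ≤ 6 * l := by linarith
  have h5 : d * Real.log (S * T / d) + Real.log (T / δ) ≤ 2 * d * l := by
    nlinarith only [h2, h3, hd1, hl0]
  have hpos : 0 ≤ T / (lam * κ * d) := by rw [hlam]; positivity
  have h6 : 0 ≤ Real.log (1 + T / (lam * κ * d)) := Real.log_nonneg (by linarith)
  refine Real.sqrt_le_iff.2 ⟨by positivity, ?_⟩
  calc _ ≤ (2 * d * l) * (6 * l) * (κ * d / T) := by gcongr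
    _ = 12 * (d ^ 2 * l ^ 2 * (κ / T)) := by ring
    _ ≤ 16 * (d ^ 2 * l ^ 2 * (κ / T)) := by gcongr; norm_num
    _ = _ := by
      rw [mul_pow, mul_pow, mul_pow, Real.sq_sqrt (by positivity)]
      ring

/-! ### The gap of a run -/

section Run

variable {X A Ω : Type*} [mΩ : MeasurableSpace Ω] {μ : Measure Ω}
  {ℱ : Filtration ℕ mΩ} {φ : X → A → Vec d} {S lam : ℝ} {θstar : Vec d} {T : ℕ}
  {x : ℕ → Ω → X} {a a' : ℕ → Ω → A} {y : ℕ → Ω → ℝ} {θhat : ℕ → Ω → Vec d} {π : Ω → X → A}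

lemma IsRun.isFeedback (h : IsRun μ ℱ φ S lam θstar T x a a' y θhat π)
    (hφ : ∀ x a, ‖φ x a‖ ≤ 1) :
    IsFeedback μ ℱ θstar T (fun t ω => φ (x t ω) (a t ω) - φ (x t ω) (a' t ω)) y where
  norm_le _ _ _ := norm_feature_sub_le hφ _ _ _
  adapted := h.adapted
  label_binary := h.label_binary
  label_adapted := h.label_adapted
  label_law := h.label_law

variable [Nonempty X] [Nonempty A]

lemma gap_le_two_mul (hφ : ∀ x a, ‖φ x a‖ ≤ 1) (hθstar : ‖θstar‖ ≤ S) (p : X → A) :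
    gap φ θstar p ≤ 2 * S := by
  refine ciSup_le fun x₀ => ciSup_le fun a₀ => ?_
  rw [← inner_sub_left]
  exact (real_inner_le_norm _ _).trans
    (mul_le_mul (norm_feature_sub_le hφ _ _ _) hθstar (norm_nonneg _) (by norm_num))

/-- The sub-optimality gap on the confidence event. -/
lemma IsRun.gap_le (h : IsRun μ ℱ φ S lam θstar T x a a' y θhat π) (hd : 1 ≤ d) (hT : 1 ≤ T)
    (hS : 0 ≤ S) (hlam : 0 < lam) (hφ : ∀ x a, ‖φ x a‖ ≤ 1) (hθstar : θstar ∈ paramSet d S)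
    {ω : Ω} {β D : ℝ}
    (hβ : ∀ t ∈ Finset.Icc 1 T, ∀ θ : Vec d, ‖θ‖ ≤ S →
      logLoss (fun s => φ (x s ω) (a s ω) - φ (x s ω) (a' s ω)) (fun s => y s ω) t θstar -
        logLoss (fun s => φ (x s ω) (a s ω) - φ (x s ω) (a' s ω)) (fun s => y s ω) t θ ≤ β)
    (hD0 : 0 ≤ D) (hDS : (4 * S) ^ 2 ≤ D)
    (hDβ : ((2 + 4 * S) * β + lam * (2 * S) ^ 2) * kappa φ S ≤ D) :
    gap φ θstar (π ω) ≤
      Real.sqrt (D * (2 * d * Real.log (1 + 4 * T / (kappa φ S * lam * d))) / T) := by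
  have hκ : 0 < kappa φ S := by linarith [four_le_kappa (φ := φ) hS hφ]
  refine ciSup_le fun x₀ => ciSup_le fun a₀ => ?_
  have hpol := h.policy ω x₀ a₀
  have hmain := inner_error_avgParam_le (w := φ x₀ a₀ - φ x₀ (π ω x₀))
    (z := fun s => φ (x s ω) (a s ω) - φ (x s ω) (a' s ω)) (θhat := fun t => θhat t ω)
    (θstar := θstar) hd hT hlam hκ
    (fun t _ => norm_feature_sub_le hφ _ _ _) (norm_feature_sub_le hφ _ _ _)
    (fun t ht s _ => one_le_kappa_mul_deriv_sigmoid hφ _ _ _ (h.estimate t ht ω).1)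
    (fun t ht => h.select t ht ω _ _ _)
    (fun t ht => by linarith [norm_sub_le θstar (θhat t ω), (h.estimate t ht ω).1.2, hθstar.2])
    (fun t ht => designMatrix_error_le (y := fun s => y s ω) hS hlam.le
      (fun s _ => norm_feature_sub_le hφ _ _ _) (h.estimate t ht ω).1 hθstar (h.estimate t ht ω).2
      (hβ t ht _ (h.estimate t ht ω).1.2))
    hD0 hDS hDβ
  -- Greediness makes the inner product of `w` with the averaged estimate nonpositive, so `⟪w,
  -- θstar⟫` is at most the error in direction `w`.
  rw [inner_sub_right, inner_sub_left, inner_sub_left] at hmain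
  linarith

end Run

end APO

/-! ### Assembly of the rate -/

theorem theorem3 :
    ∃ C : ℝ, 0 < C ∧
      ∀ (X A Ω : Type*) [Nonempty X] [Nonempty A] [mΩ : MeasurableSpace Ω]
        (μ : Measure Ω) [IsProbabilityMeasure μ] (ℱ : Filtration ℕ mΩ)
        (d T : ℕ) (S lam δ : ℝ) (φ : X → A → APO.Vec d) (θstar : APO.Vec d)
        (x : ℕ → Ω → X) (a a' : ℕ → Ω → A) (y : ℕ → Ω → ℝ) (θhat : ℕ → Ω → APO.Vec d)
        (π : Ω → X → A),
        1 ≤ d → 2 ≤ T → 1 ≤ S → (d : ℝ) ≤ S * T → 0 < δ → δ ≤ 1 →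
        θstar ∈ APO.paramSet d S →
        (∀ (x₀ : X) (a₀ : A), ‖φ x₀ a₀‖ ≤ 1) →
        lam = 1 / (4 * S ^ 2 * (2 + 2 * S) ^ 2) →
        APO.IsRun μ ℱ φ S lam θstar T x a a' y θhat π →
        ∃ E : Set Ω, MeasurableSet E ∧ 1 - δ ≤ μ.real E ∧
          ∀ ω ∈ E,
            APO.gap φ θstar (π ω) ≤
                C * S ^ (3 / 2 : ℝ) *
                  Real.sqrt ((d * Real.log (S * T / d) + Real.log (T / δ))
                    * Real.log (1 + T / (lam * APO.kappa φ S * d))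
                    * (APO.kappa φ S * d / T)) ∧
              APO.gap φ θstar (π ω) ≤
                C * S ^ (3 / 2 : ℝ) * d * Real.sqrt (APO.kappa φ S / T)
                  * Real.log (S * T / δ) := by
  -- The first bound needs `16`; `sqrt_rate_le` contributes another factor `4` to the second.
  refine ⟨64, by norm_num, ?_⟩
  intro X A Ω _ _ mΩ μ _ ℱ d T S lam δ φ θstar x a a' y θhat π hd hT hS hdST hδ hδ1 hθstar hφ
    hlam hrun
  have hS0 : 0 < S := by linarith
  have hd0 : (0 : ℝ) < d := by exact_mod_cast hd
  have hT0 : (0 : ℝ) < T := by positivity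
  have hlam0 : 0 < lam := by rw [hlam]; positivity
  have hκ := APO.four_le_kappa (φ := φ) hS0.le hφ
  have hlog := APO.half_le_log_div hT hδ hδ1
  have hlogd : 0 ≤ Real.log (S * T / d) := Real.log_nonneg (by rwa [one_le_div hd0])
  have hsqrt := APO.sqrt_rate_le hd hT hS hδ hδ1 hκ hlam
  have hSpow := APO.le_rpow_three_halves hS
  obtain ⟨E, hEm, hE, hconf⟩ :=
    (hrun.isFeedback hφ).exists_confidence hd (by omega) hS0.le hδ
  refine ⟨E, hEm, hE, fun ω hω => ?_⟩
  have hgapD := fun D => hrun.gap_le (D := D) hd (by omega) hS0.le hlam0 hφ hθstar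
    (fun t ht θ hθ => hconf ω hω t ht θ hθ)
  have htriv := APO.gap_le_two_mul hφ hθstar.2 (π ω)
  clear hconf hrun
  generalize APO.gap φ θstar (π ω) = gap at *
  generalize APO.kappa φ S = κ at *
  set B := d * Real.log (S * T / d) + Real.log (T / δ) with hBdef
  set Q := B * Real.log (1 + T / (lam * κ * d)) * (κ * d / T) with hQ
  clear_value B
  clear_value Q
  have hκ0 : 0 < κ := by linarith
  have hB : 1 / 2 ≤ B := by
    have := mul_nonneg hd0.le hlogd
    linarith
  have hlamS : lam * (2 * S) ^ 2 ≤ 1 / 16 := by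
    have e : lam * (2 * S) ^ 2 = 1 / (2 + 2 * S) ^ 2 := by rw [hlam]; field_simp; ring
    rw [e]
    apply one_div_le_one_div_of_le (by norm_num)
    nlinarith only [hS]
  -- The argument yields the power `S`, which is stronger than `S ^ (3 / 2)`. Below `S T = 3 d`,
  -- `log (S T / d)` may vanish and cannot absorb the confidence radius, but there `Q ≥ 1 / 4` and
  -- the trivial bound suffices.
  have hgap : gap ≤ 16 * (S * Real.sqrt Q) := by
    rcases lt_or_ge (S * T) (3 * d) with hsmall | hlarge
    · have hlam1 : lam ≤ 1 := by nlinarith only [hlamS, hS, hlam0]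
      have hQ4 : 1 / 4 ≤ Q := hQ ▸
        APO.quarter_le_rate_of_small hd (by omega) hS hlam0 hlam1 hκ hB hsmall
      have h1 : 1 / 2 ≤ Real.sqrt Q := Real.le_sqrt_of_sq_le (by linarith)
      nlinarith only [htriv, h1, hS]
    · have hβ := APO.confidence_radius_le hd (by linarith) hlarge
      have hSB : 1 / 2 ≤ S * B := by nlinarith only [hS, hB]
      have hρ : (2 + 4 * S) * (Real.log (T / δ) + d * Real.log (1 + 2 * (S * T / d)) + 2 * d)
          + lam * (2 * S) ^ 2 ≤ 31 * (S * B) := by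
        calc _ ≤ (2 + 4 * S) * (5 * B) + 1 / 16 := by rw [hBdef]; gcongr
          _ ≤ _ := by nlinarith only [hS, hB, hSB]
      have hS2 : S * B ≤ S ^ 2 * B := by nlinarith only [hS, hSB]
      have hBκ : 2 ≤ B * κ := by nlinarith only [hB, hκ]
      have hB0 : 0 < B := by linarith
      -- The second factor `S` lets `D` dominate the squared crude bound `16 * S ^ 2` as well; `B *
      -- κ ≥ 2` does the rest. The final constant is `31 * 2 * 4 = 248 ≤ 16 ^ 2`.
      have h := hgapD (31 * (S ^ 2 * B) * κ) (by positivity)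
        (by nlinarith only [mul_le_mul_of_nonneg_left hBκ (sq_nonneg S), sq_nonneg S])
        (mul_le_mul_of_nonneg_right (hρ.trans (by linarith only [hS2])) hκ0.le)
      refine h.trans ?_
      have hu : 0 ≤ T / (lam * κ * d) := by positivity
      have e4 : 4 * T / (κ * lam * d) = 4 * (T / (lam * κ * d)) := by ring
      have hl4 := APO.log_one_add_four_mul_le hu
      refine Real.sqrt_le_iff.2 ⟨by positivity, ?_⟩
      have hl0 : 0 ≤ Real.log (1 + T / (lam * κ * d)) := Real.log_nonneg (by linarith)
      have hQ0 : 0 ≤ Q := by rw [hQ]; positivity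
      rw [mul_pow, mul_pow, Real.sq_sqrt hQ0]
      calc _ ≤ 31 * (S ^ 2 * B) * κ * (2 * d * (4 * Real.log (1 + T / (lam * κ * d)))) / T := by
            rw [e4]; gcongr
        _ = 248 * (S ^ 2 * Q) := by simp only [hQ]; ring
        _ ≤ 16 ^ 2 * (S ^ 2 * Q) := by gcongr; norm_num
  have hgap' : gap ≤ 16 * (S ^ (3 / 2 : ℝ) * Real.sqrt Q) :=
    hgap.trans (by gcongr)
  have hnn : 0 ≤ S ^ (3 / 2 : ℝ) * Real.sqrt Q := by positivity
  refine ⟨by linarith, hgap'.trans ?_⟩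
  calc 16 * (S ^ (3 / 2 : ℝ) * Real.sqrt Q) ≤
      16 * (S ^ (3 / 2 : ℝ) * (4 * d * Real.sqrt (κ / T) * Real.log (S * T / δ))) := by gcongr
    _ = _ := by ring
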